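/- Let $(X,d)$ be a metric space and let $\phi:X\to(-\infty,+\infty]$ be proper and lower semicontinuous, with domain $\mathrm{Dom}(\phi)=\{\phi<+\infty\}$. Definitions. - For $\lambda\in\mathbb R$, a solution of $\mathrm{EVI}_\lambda$ is a continuous curve $u:(0,\infty)\to\mathrm{Dom}(\phi)$ such that $$\tfrac12\,\limsup_{h\downarrow0}\frac{d^2(u_{t+h},v)-d^2(u_t,v)}{h}+\tfrac\lambda2\, d^2(u_t,v)\le\phi(v)-\phi(u_t)\qquad\text{for all }t>0,\ v\in\mathrm{Dom}(\phi).$$ - An $\mathrm{EVI}_\lambda$-gradient flow of $\phi$ in $D\subset\overline{\mathrm{Dom}(\phi)}$ is a family of continuous maps $S_t:D\to D$, $t\ge0$, such that for every $u_0\in D$ one has $S_{t+h}(u_0)=S_h(S_t(u_0))$ for all $t,h\ge0$, $\lim_{t\downarrow0}S_t(u_0)=S_0(u_0)=u_0$, and $t\mapsto S_t(u_0)$ is a solution of $\mathrm{EVI}_\lambda$. - $\phi$ is approximately $\lambda$-convex in $D$ if for all $x_0,x_1\in D\cap\mathrm{Dom}(\phi)$ and all $\vartheta,\varepsilon\in(0,1)$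 there is $x\in D$ with $$\frac{d^2(x_0,x)}{\vartheta}+\frac{d^2(x,x_1)}{1-\vartheta}\le d^2(x_0,x_1)\bigl(1+\varepsilon^2\vartheta(1-\vartheta)\bigr)$$ and $$\phi(x)\le(1-\vartheta)\phi(x_0)+\vartheta\phi(x_1)-\tfrac{\lambda-\varepsilon}{2}\,\vartheta(1-\vartheta)\,d^2(x_0,x_1).$$ - For $\tau>0$ and $\eta\ge0$, a $(\tau,\eta)$-discrete Minimizing Movement is a sequence $(U^n)_{n\ge0}$ in $\mathrm{Dom}(\phi)$ such that for every $n\ge1$ $$\tfrac1{2\tau}d^2(U^n,U^{n-1})+\phi(U^n)\le\tfrac1{2\tau}d^2(V,U^{n-1})+\phi(V)+\tfrac\eta2\, d(U^n,U^{n-1})\,d(V,U^n)\qquad\text{for all }V\in X,$$ $$\tfrac1{2\tau}d^2(U^n,U^{n-1})+\phi(U^n)\le\phi(U^{n-1}).$$ Its piecewise constant interpolant is $\bar U(t)=U^n$ for $t\in((n-1)\tau,n\tau]$, $n\ge1$, and $\bar U(0)=U^0$. - Set $t_\tau=\min\{k\tau:k\in\mathbb N,\ k\tau\ge t\}$, $\mathsf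 E_\mu(t)=\int_0^t e^{\mu r}\,dr$, and $\phi_\sigma(x)=\inf_{y\in X}\bigl(\phi(y)+\tfrac1{2\sigma}d^2(y,x)\bigr)$ for $\sigma>0$. Theorem 5.9 (Uniform error estimate for data in $\mathrm{Dom}(\phi)$). Let $\lambda\le0$, let $(S_t)_{t\ge0}$ be an $\mathrm{EVI}_\lambda$-gradient flow of $\phi$ in $D\subset\overline{\mathrm{Dom}(\phi)}$, and let $\phi$ be approximately $\lambda$-convex in $D$. Let $\tau\in(0,1)$ and $\eta\ge0$, put $\gamma=2\eta-3\lambda$, assume $4\gamma\tau\le1$, and let $(U^n)_{n\ge0}\subset D\cap\mathrm{Dom}(\phi)$ be a $(\tau,\eta)$-discrete Minimizing Movement. Then for every $u_0\in D$ and every $t>0$ the number $\phi_{\mathsf E_{\lambda-\eta}(3\sqrt{\tau t_\tau})}(U^0)$ is finite and $$d\bigl(S_t(u_0),\bar U(t)\bigr)\le e^{-\lambda t}\,d(u_0,U^0)+10\,\sqrt[4]{\tau t_\tau}\;e^{2\gamma t_\tau}\,\sqrt{\phi(U^0)-\phi_{\mathsf E_{\lambda-\eta}(3\sqrt{\tau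 t_\tau})}(U^0)}.$$ -/

import Mathlib

namespace EVIFlow

/-- The effective domain `{x | φ x < +∞}` of an extended-real functional. -/
def dom {X : Type*} (φ : X → EReal) : Set X := {x | φ x < ⊤}

/-- The upper right Dini derivative `limsup_{h ↓ 0} (ζ (t + h) - ζ t) / h`, with values in `[-∞, +∞]`. -/
noncomputable def upperRightDini (ζ : ℝ → ℝ) (t : ℝ) : EReal :=
  Filter.limsup (fun h : ℝ => (((ζ (t + h) - ζ t) / h : ℝ) : EReal)) (nhdsWithin 0 (Set.Ioi 0))

/-- Solutions of the Evolution Variational Inequality with parameter `lam`: continuous curves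
`u : (0, +∞) → dom φ` with
`1/2 d⁺/dt dist(u_t, v)^2 + lam/2 dist(u_t, v)^2 ≤ φ v - φ u_t` for all `t > 0`, `v ∈ dom φ`.
Values of `u` outside `(0, +∞)` play no role. -/
structure IsEVISolution {X : Type*} [MetricSpace X] (φ : X → EReal) (lam : ℝ) (u : ℝ → X) :
    Prop where
  continuousOn : ContinuousOn u (Set.Ioi 0)
  mem_dom : ∀ t : ℝ, 0 < t → u t ∈ dom φ
  evi : ∀ t : ℝ, 0 < t → ∀ v ∈ dom φ,
    ((1 / 2 : ℝ) : EReal) * upperRightDini (fun s => dist (u s) v ^ 2) t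
      + ((lam / 2 * dist (u t) v ^ 2 : ℝ) : EReal) ≤ φ v - φ (u t)

/-- `S` is an EVI gradient flow of `φ` in `D`, with parameter `lam`: `D` lies in the closure of
`dom φ`, and `(S t)_{t ≥ 0}` is a semigroup of continuous maps `D → D`, continuous at `t = 0`, whose
trajectories solve the EVI. Values for negative times or outside `D` play no role. -/
structure IsEVIGradientFlow {X : Type*} [MetricSpace X] (φ : X → EReal) (lam : ℝ) (D : Set X)
    (S : ℝ → X → X) : Prop where
  subset_closure : D ⊆ closure (dom φ)
  mapsTo : ∀ t : ℝ, 0 ≤ t → Set.MapsTo (S t) D D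
  continuousOn : ∀ t : ℝ, 0 ≤ t → ContinuousOn (S t) D
  semigroup : ∀ u₀ ∈ D, ∀ t h : ℝ, 0 ≤ t → 0 ≤ h → S (t + h) u₀ = S h (S t u₀)
  zero : ∀ u₀ ∈ D, S 0 u₀ = u₀
  tendsto_zero : ∀ u₀ ∈ D,
    Filter.Tendsto (fun t : ℝ => S t u₀) (nhdsWithin 0 (Set.Ioi 0)) (nhds u₀)
  isEVISolution : ∀ u₀ ∈ D, IsEVISolution φ lam (fun t => S t u₀)

/-- `x` is a `(θ, ε)`-intermediate point between `x₀` and `x₁`. -/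
def IsIntermediatePoint {X : Type*} [MetricSpace X] (θ ε : ℝ) (x₀ x₁ x : X) : Prop :=
  dist x₀ x ^ 2 / θ + dist x x₁ ^ 2 / (1 - θ) ≤ dist x₀ x₁ ^ 2 * (1 + ε ^ 2 * θ * (1 - θ))

/-- Approximate `lam`-convexity of `φ` in `D`. -/
def ApproxConvexIn {X : Type*} [MetricSpace X] (φ : X → EReal) (lam : ℝ) (D : Set X) : Prop :=
  ∀ x₀ ∈ D ∩ dom φ, ∀ x₁ ∈ D ∩ dom φ, ∀ θ ∈ Set.Ioo (0 : ℝ) 1, ∀ ε ∈ Set.Ioo (0 : ℝ) 1,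
    ∃ x ∈ D, IsIntermediatePoint θ ε x₀ x₁ x ∧
      φ x ≤ ((1 - θ : ℝ) : EReal) * φ x₀ + (θ : EReal) * φ x₁
        - (((lam - ε) / 2 * θ * (1 - θ) * dist x₀ x₁ ^ 2 : ℝ) : EReal)

/-- The quadratic Moreau-Yosida regularization `φ_σ(x) = inf_y (φ y + dist(y, x)^2 / (2σ))`. -/
noncomputable def moreauYosida {X : Type*} [MetricSpace X] (φ : X → EReal) (σ : ℝ) (x : X) :
    EReal :=
  ⨅ y : X, φ y + ((1 / (2 * σ) * dist y x ^ 2 : ℝ) : EReal)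

/-- The Moreau-Yosida-Ekeland resolvent `J_{τ,η}[x]`. -/
def resolvent {X : Type*} [MetricSpace X] (φ : X → EReal) (τ η : ℝ) (x : X) : Set X :=
  {z | z ∈ dom φ ∧
    (∀ y : X, ((1 / (2 * τ) * dist x z ^ 2 : ℝ) : EReal) + φ z ≤
      ((1 / (2 * τ) * dist x y ^ 2 : ℝ) : EReal) + φ y
        + ((η / 2 * dist x z * dist y z : ℝ) : EReal)) ∧
    ((1 / (2 * τ) * dist x z ^ 2 : ℝ) : EReal) + φ z ≤ φ x}

/-- `(τ, η)`-discrete Minimizing Movements (starting from `U 0`). -/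
def IsDiscreteMinimizingMovement {X : Type*} [MetricSpace X] (φ : X → EReal) (τ η : ℝ)
    (U : ℕ → X) : Prop :=
  (∀ n : ℕ, U n ∈ dom φ) ∧ ∀ n : ℕ, U (n + 1) ∈ resolvent φ τ η (U n)

/-- The first grid time `t_τ = min {k τ : k ∈ ℕ, k τ ≥ t}`; see `isLeast_gridTime`. -/
noncomputable def gridTime (τ t : ℝ) : ℝ := (⌈t / τ⌉₊ : ℝ) * τ

theorem isLeast_gridTime {τ : ℝ} (hτ : 0 < τ) (t : ℝ) :
    IsLeast {s : ℝ | ∃ k : ℕ, s = k * τ ∧ t ≤ s} (gridTime τ t) := by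
  refine ⟨⟨_, rfl, ?_⟩, ?_⟩
  · exact (div_le_iff₀ hτ).1 (Nat.le_ceil (t / τ))
  · rintro s ⟨k, rfl, hk⟩
    have h : ⌈t / τ⌉₊ ≤ k := Nat.ceil_le.2 ((div_le_iff₀ hτ).2 hk)
    exact mul_le_mul_of_nonneg_right (by exact_mod_cast h) hτ.le

/-- The piecewise constant interpolant: it equals `U n` on `((n - 1) τ, n τ]` and `U 0` at `0`;
see `interpolant_eq` and `interpolant_zero`. -/
noncomputable def interpolant {X : Type*} (τ : ℝ) (U : ℕ → X) (t : ℝ) : X := U ⌈t / τ⌉₊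

theorem interpolant_zero {X : Type*} (τ : ℝ) (U : ℕ → X) : interpolant τ U 0 = U 0 := by
  simp [interpolant]

theorem interpolant_eq {X : Type*} {τ : ℝ} (hτ : 0 < τ) (U : ℕ → X) {n : ℕ} (hn : 1 ≤ n) {t : ℝ}
    (h1 : ((n : ℝ) - 1) * τ < t) (h2 : t ≤ n * τ) : interpolant τ U t = U n := by
  have h : ⌈t / τ⌉₊ = n := by
    rw [Nat.ceil_eq_iff (by omega)]
    refine ⟨?_, (div_le_iff₀ hτ).2 h2⟩
    rw [Nat.cast_sub hn, Nat.cast_one]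
    exact (lt_div_iff₀ hτ).2 h1
  rw [interpolant, h]

/-- `E_μ(t) = ∫_0^t e^{μ r} dr`. -/
noncomputable def expPrimitive (μ t : ℝ) : ℝ := ∫ r in (0 : ℝ)..t, Real.exp (μ * r)

end EVIFlow

/-! ### Comparison principles for Dini derivatives -/

namespace EVIFlow

open Filter Topology Set

/-! By contraction of the flow (`IsEVIGradientFlow.dist_le`) it suffices to start both flow and
scheme from `U 0`. The core is the one-step estimate `IsEVIGradientFlow.dist_sq_step_le`. If `z` is
a minimizing step out of `w`, minimality along near-geodesics bounds the global slope of `φ` at `z`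
by about `dist w z / τ` (`toReal_sub_le_of_mem_resolvent`). Finite slope upgrades the EVI to a
second-order estimate (`IsEVIGradientFlow.dist_sq_le_of_slope`), and testing it at the next point
`z'` bounds the squared local error by `dist w z ^ 2 - dist z z' ^ 2`, up to a factor `exp (O(γ τ))`
on the first term. So the squared errors telescope, and Cauchy-Schwarz
(`le_of_telescoping_recursion`) bounds the error after `n` steps by `√n` times a single
displacement.

Near `U 0` that displacement may be too large, the slope there being possibly infinite. Hence an
initial layer of length `κ = (j + 1) τ` is set aside. Displacements almost decrease and their
squares sum to `O(τ M)`, where `M` is the energy of `U 0` minus its regularization, so the last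
displacement in the layer has square `O(τ² M / κ)`. The later error is then `O(r √(M / κ))`, with
`r² = τ t_τ`, while inside the layer flow and scheme separate by `O(√(κ M))`. Taking `κ` comparable
to `r`, as far as `γ` permits, balances both at `√(r M)`, whence the fourth root. -/

/-- The upper right Dini derivative of `ζ` at `t` is at most the real number `c`. -/
def RightSlopeLE (ζ : ℝ → ℝ) (t c : ℝ) : Prop :=
  ∀ r, c < r → ∀ᶠ z in 𝓝[>] t, slope ζ t z < r

theorem RightSlopeLE.mono {ζ : ℝ → ℝ} {t c c' : ℝ} (h : RightSlopeLE ζ t c) (hc : c ≤ c') :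
    RightSlopeLE ζ t c' := fun r hr => h r (hc.trans_lt hr)

/-- A comparison principle for Dini derivatives; strictness is only needed at contact points. -/
theorem RightSlopeLE.le_of_lt_deriv {f f' B B' : ℝ → ℝ} {a b : ℝ} (hab : a ≤ b)
    (hf : ContinuousOn f (Icc a b)) (hf' : ∀ x ∈ Ico a b, RightSlopeLE f x (f' x))
    (ha : f a ≤ B a) (hB : ∀ x, HasDerivAt B (B' x) x)
    (bound : ∀ x ∈ Ico a b, f x = B x → f' x < B' x) : f b ≤ B b :=
  image_le_of_liminf_slope_right_lt_deriv_boundary' hf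
    (fun x hx r hr => (hf' x hx r hr).frequently) ha
    (fun x _ => (hB x).continuousAt.continuousWithinAt)
    (fun x _ => (hB x).hasDerivWithinAt) bound (right_mem_Icc.2 hab)

/-- Gronwall-type comparison for a linear differential inequality `f' ≤ κ + l f`. -/
theorem RightSlopeLE.le_of_linear {f κ B B' : ℝ → ℝ} {a b l : ℝ} (hab : a ≤ b)
    (hf : ContinuousOn f (Icc a b)) (hf' : ∀ x ∈ Ico a b, RightSlopeLE f x (κ x + l * f x))
    (ha : f a ≤ B a) (hB : ∀ x, HasDerivAt B (B' x) x)
    (bound : ∀ x ∈ Ico a b, κ x + l * B x ≤ B' x) : f b ≤ B b := by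
  -- The perturbation `ε * exp ((1 + l) x)` grows at a rate larger than `l`, which makes the
  -- inequality strict at contact points.
  have key : ∀ ε : ℝ, 0 < ε → f b ≤ B b + ε * Real.exp ((1 + l) * b) := by
    intro ε hε
    refine RightSlopeLE.le_of_lt_deriv (B := fun x => B x + ε * Real.exp ((1 + l) * x))
      (B' := fun x => B' x + ε * (Real.exp ((1 + l) * x) * ((1 + l) * 1))) hab hf hf' ?_ ?_ ?_
    · have := mul_pos hε (Real.exp_pos ((1 + l) * a))
      linarith
    · intro x
      exact (hB x).add ((((hasDerivAt_id x).const_mul (1 + l)).exp).const_mul ε)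
    · intro x hx h
      have h1 := bound x hx
      have h2 := mul_pos hε (Real.exp_pos ((1 + l) * x))
      rw [h]
      nlinarith
  have hlim : Tendsto (fun ε : ℝ => B b + ε * Real.exp ((1 + l) * b)) (𝓝[>] 0) (𝓝 (B b)) := by
    have : Tendsto (fun ε : ℝ => B b + ε * Real.exp ((1 + l) * b)) (𝓝 0)
        (𝓝 (B b + 0 * Real.exp ((1 + l) * b))) := by
      apply Continuous.tendsto
      fun_prop
    rw [zero_mul, add_zero] at this
    exact this.mono_left nhdsWithin_le_nhds
  exact ge_of_tendsto hlim (eventually_nhdsWithin_of_forall fun ε hε => key ε hε)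

/-! ### The exponential primitive -/

theorem hasDerivAt_expPrimitive (μ t : ℝ) :
    HasDerivAt (expPrimitive μ) (Real.exp (μ * t)) t := by
  have hc : Continuous fun r : ℝ => Real.exp (μ * r) := by fun_prop
  exact intervalIntegral.integral_hasDerivAt_right (hc.intervalIntegrable _ _)
    (hc.stronglyMeasurableAtFilter _ _) hc.continuousAt

@[simp] theorem expPrimitive_zero (μ : ℝ) : expPrimitive μ 0 = 0 := by
  simp [expPrimitive]

/-- Division-free form of the fundamental theorem of calculus, valid also for `μ = 0`. It is what
verifies that the comparison functions below solve their linear equations. -/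
theorem one_add_mul_expPrimitive (μ t : ℝ) : 1 + μ * expPrimitive μ t = Real.exp (μ * t) := by
  have h : ∫ r in (0 : ℝ)..t, Real.exp (μ * r) * (μ * 1) =
      Real.exp (μ * t) - Real.exp (μ * 0) :=
    intervalIntegral.integral_eq_sub_of_hasDerivAt
      (f := fun r => Real.exp (μ * r))
      (fun x _ => ((hasDerivAt_id x).const_mul μ).exp)
      (Continuous.intervalIntegrable (by fun_prop) _ _)
  rw [intervalIntegral.integral_mul_const, mul_zero, Real.exp_zero, mul_one] at h
  unfold expPrimitive
  linarith

theorem expPrimitive_mono_right (μ : ℝ) : Monotone (expPrimitive μ) :=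
  monotone_of_hasDerivAt_nonneg (hasDerivAt_expPrimitive μ) fun _ => (Real.exp_pos _).le

theorem expPrimitive_nonneg (μ : ℝ) {t : ℝ} (ht : 0 ≤ t) : 0 ≤ expPrimitive μ t := by
  simpa using expPrimitive_mono_right μ ht

theorem expPrimitive_mono_left {μ ν t : ℝ} (h : μ ≤ ν) (ht : 0 ≤ t) :
    expPrimitive μ t ≤ expPrimitive ν t := by
  refine intervalIntegral.integral_mono_on ht (Continuous.intervalIntegrable (by fun_prop) _ _)
    (Continuous.intervalIntegrable (by fun_prop) _ _) fun x hx => Real.exp_le_exp.2 ?_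
  exact mul_le_mul_of_nonneg_right h hx.1

theorem expPrimitive_zero_left (t : ℝ) : expPrimitive 0 t = t := by
  simp [expPrimitive]

theorem le_expPrimitive {l t : ℝ} (hl : 0 ≤ l) (ht : 0 ≤ t) : t ≤ expPrimitive l t := by
  simpa [expPrimitive_zero_left] using expPrimitive_mono_left hl ht

theorem mul_exp_le_expPrimitive {μ t : ℝ} (hμ : μ ≤ 0) (ht : 0 ≤ t) :
    t * Real.exp (μ * t) ≤ expPrimitive μ t := by
  have h : ∫ _r in (0 : ℝ)..t, Real.exp (μ * t) ≤ expPrimitive μ t := by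
    refine intervalIntegral.integral_mono_on ht (Continuous.intervalIntegrable (by fun_prop) _ _)
      (Continuous.intervalIntegrable (by fun_prop) _ _) fun x hx => Real.exp_le_exp.2 ?_
    exact mul_le_mul_of_nonpos_left hx.2 hμ
  simpa using h

theorem expPrimitive_le_mul_exp {l t : ℝ} (hl : 0 ≤ l) (ht : 0 ≤ t) :
    expPrimitive l t ≤ t * Real.exp (l * t) := by
  have h : expPrimitive l t ≤ ∫ _r in (0 : ℝ)..t, Real.exp (l * t) := by
    refine intervalIntegral.integral_mono_on ht (Continuous.intervalIntegrable (by fun_prop) _ _)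
      (Continuous.intervalIntegrable (by fun_prop) _ _) fun x hx => Real.exp_le_exp.2 ?_
    exact mul_le_mul_of_nonneg_left hx.2 hl
  simpa using h

/-- This is the reflection `r ↦ t - r` of the integral; here it follows algebraically after
multiplying by `l`, so `l = 0` is separate. -/
theorem expPrimitive_neg_mul_exp (l t : ℝ) :
    expPrimitive (-l) t * Real.exp (l * t) = expPrimitive l t := by
  rcases eq_or_ne l 0 with rfl | hl
  · simp
  · have h1 := one_add_mul_expPrimitive l t
    have h2 := one_add_mul_expPrimitive (-l) t
    have h3 : Real.exp (-l * t) * Real.exp (l * t) = 1 := by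
      rw [← Real.exp_add]; simp
    apply mul_left_cancel₀ hl
    linear_combination -h1 - h3 - Real.exp (l * t) * h2

theorem coe_toReal_of_mem_dom {X : Type*} {φ : X → EReal} (hφ : ∀ x, φ x ≠ ⊥) {x : X} (hx : x ∈ dom φ) :
    ((φ x).toReal : EReal) = φ x := EReal.coe_toReal (ne_of_lt hx) (hφ x)

/-! ### Integrated form of the EVI -/

variable {X : Type*} [MetricSpace X] {φ : X → EReal} {lam : ℝ}

/-- The EVI in terms of real-valued difference quotients. -/
theorem IsEVISolution.rightSlopeLE (hφ : ∀ x, φ x ≠ ⊥) {u : ℝ → X} (hu : IsEVISolution φ lam u)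
    {t : ℝ} (ht : 0 < t) {v : X} (hv : v ∈ dom φ) :
    RightSlopeLE (fun s => dist (u s) v ^ 2) t
      (2 * ((φ v).toReal - (φ (u t)).toReal) + (-lam) * dist (u t) v ^ 2) := by
  intro r hr
  have h := hu.evi t ht v hv
  rw [← coe_toReal_of_mem_dom hφ hv, ← coe_toReal_of_mem_dom hφ (hu.mem_dom t ht),
    ← EReal.coe_sub] at h
  -- The limsup may be infinite, so it is never converted to a real: only the assumption that it is
  -- at least `r` is inserted into the EVI.
  have hL : upperRightDini (fun s => dist (u s) v ^ 2) t < (r : EReal) := by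
    by_contra! hcon
    have h1 : ((1 / 2 * r + lam / 2 * dist (u t) v ^ 2 : ℝ) : EReal) ≤
        (((φ v).toReal - (φ (u t)).toReal : ℝ) : EReal) := by
      refine le_trans ?_ h
      rw [EReal.coe_add, EReal.coe_mul]
      gcongr
    rw [EReal.coe_le_coe_iff] at h1
    linarith
  have hev := eventually_lt_of_limsup_lt hL
  have hmap : Tendsto (fun z : ℝ => z - t) (𝓝[>] t) (𝓝[>] 0) := by
    refine tendsto_nhdsWithin_iff.2 ⟨?_, ?_⟩
    · have : Tendsto (fun z : ℝ => z - t) (𝓝 t) (𝓝 (t - t)) := by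
        apply Continuous.tendsto; fun_prop
      rw [sub_self] at this
      exact this.mono_left nhdsWithin_le_nhds
    · filter_upwards [self_mem_nhdsWithin] with z hz
      exact sub_pos.2 (mem_Ioi.1 hz)
  filter_upwards [hmap.eventually hev] with z hz
  rw [EReal.coe_lt_coe_iff] at hz
  rw [slope_def_field]
  simpa using hz

theorem IsEVISolution.continuousOn_dist_sq {u : ℝ → X} (hu : IsEVISolution φ lam u) (v : X)
    {a b : ℝ} (ha : 0 < a) : ContinuousOn (fun s => dist (u s) v ^ 2) (Icc a b) := by
  have : ContinuousOn u (Icc a b) := hu.continuousOn.mono fun x hx => lt_of_lt_of_le ha hx.1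
  fun_prop

/-- Lower semicontinuity of `φ` along a continuous curve, in real form. Every use of `hlsc` goes
through this lemma. -/
theorem IsEVISolution.eventually_lt_toReal (hφ : ∀ x, φ x ≠ ⊥) (hlsc : LowerSemicontinuous φ)
    {u : ℝ → X} (hu : IsEVISolution φ lam u) {t c : ℝ} (ht : 0 < t)
    (hc : c < (φ (u t)).toReal) : ∀ᶠ z in 𝓝 t, c < (φ (u z)).toReal := by
  have h1 : (c : EReal) < φ (u t) := by
    rw [← coe_toReal_of_mem_dom hφ (hu.mem_dom t ht)]
    exact_mod_cast hc
  have hcont : ContinuousAt u t := hu.continuousOn.continuousAt (Ioi_mem_nhds ht)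
  filter_upwards [hcont.eventually (hlsc (u t) c h1), Ioi_mem_nhds ht] with z hz hz0
  rw [← coe_toReal_of_mem_dom hφ (hu.mem_dom z hz0)] at hz
  exact_mod_cast hz

/-- The energy decreases along solutions of the EVI. -/
theorem IsEVISolution.antitoneOn (hφ : ∀ x, φ x ≠ ⊥) (hlsc : LowerSemicontinuous φ)
    {u : ℝ → X} (hu : IsEVISolution φ lam u) :
    AntitoneOn (fun t => (φ (u t)).toReal) (Ioi 0) := by
  intro s hs t ht hst
  by_contra! hcon
  set g : ℝ → ℝ := fun t => (φ (u t)).toReal with hg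
  -- The supremum `p` is the last time at which the energy does not exceed its value at `s`; lower
  -- semicontinuity puts `p` itself in this set.
  set A : Set ℝ := {x | x ∈ Icc s t ∧ g x ≤ g s} with hA
  have hsA : s ∈ A := ⟨⟨le_rfl, hst⟩, le_rfl⟩
  have hAb : BddAbove A := ⟨t, fun x hx => hx.1.2⟩
  set p := sSup A with hp
  have hsp : s ≤ p := le_csSup hAb hsA
  have hp0 : 0 < p := lt_of_lt_of_le hs hsp
  have hpt : p ≤ t := csSup_le ⟨s, hsA⟩ fun x hx => hx.1.2
  have hgp : g p ≤ g s := by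
    by_contra! hlt
    obtain ⟨δ, hδ, hball⟩ := Metric.eventually_nhds_iff.1
      (hu.eventually_lt_toReal hφ hlsc hp0 hlt)
    obtain ⟨x, hxA, hx⟩ := exists_lt_of_lt_csSup ⟨s, hsA⟩ (sub_lt_self p hδ)
    have hxp : x ≤ p := le_csSup hAb hxA
    have := hball (y := x) (by rw [Real.dist_eq, abs_lt]; constructor <;> linarith)
    exact absurd hxA.2 (not_le.2 this)
  have hpt' : p < t := lt_of_le_of_ne hpt fun h => by
    rw [h] at hgp; exact absurd hgp (not_le.2 hcon)
  have hgt : ∀ x ∈ Ioc p t, g p < g x := by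
    intro x hx
    refine lt_of_le_of_lt hgp ?_
    by_contra! hle
    exact absurd (le_csSup hAb (show x ∈ A from ⟨⟨hsp.trans hx.1.le, hx.2⟩, hle⟩))
      (not_le.2 hx.1)
  -- In the EVI tested at `u p` the energy term is nonpositive after `p`, so Gronwall freezes the
  -- curve at `u p`, where the energy is too low.
  have hzero : dist (u t) (u p) ^ 2 ≤ 0 := by
    refine RightSlopeLE.le_of_linear (f := fun x => dist (u x) (u p) ^ 2) (κ := fun _ => 0)
      (B := fun _ => 0) (B' := fun _ => 0) (l := -lam) hpt
      (hu.continuousOn_dist_sq (u p) hp0) ?_ (by simp) (fun x => hasDerivAt_const x 0) (by simp)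
    intro x hx
    refine (hu.rightSlopeLE hφ (hp0.trans_le hx.1) (hu.mem_dom p hp0)).mono ?_
    have : g p ≤ g x := by
      rcases eq_or_lt_of_le hx.1 with h | h
      · rw [h]
      · exact (hgt x ⟨h, hx.2.le⟩).le
    simp only [hg] at this
    linarith
  have heq : u t = u p := by
    have : dist (u t) (u p) = 0 := pow_eq_zero_iff (two_ne_zero) |>.1
      (le_antisymm hzero (sq_nonneg _))
    exact dist_eq_zero.1 this
  have := hgt t ⟨hpt', le_rfl⟩
  simp only [hg, heq] at this
  exact lt_irrefl _ this

/-- The integrated EVI between positive times. -/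
theorem IsEVISolution.dist_sq_le (hφ : ∀ x, φ x ≠ ⊥) (hlsc : LowerSemicontinuous φ)
    {u : ℝ → X} (hu : IsEVISolution φ lam u) {s h : ℝ} (hs : 0 < s) (hh : 0 ≤ h) {v : X}
    (hv : v ∈ dom φ) :
    dist (u (s + h)) v ^ 2 ≤ Real.exp (-lam * h) * dist (u s) v ^ 2
      + 2 * expPrimitive (-lam) h * ((φ v).toReal - (φ (u (s + h))).toReal) := by
  -- The energy decreases, so its final value may replace the running one; the inequality then has
  -- constant coefficients.
  set c := (φ v).toReal - (φ (u (s + h))).toReal with hc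
  have := RightSlopeLE.le_of_linear (f := fun x => dist (u x) v ^ 2) (κ := fun _ => 2 * c)
    (B := fun x => Real.exp (-lam * (x - s)) * dist (u s) v ^ 2
      + 2 * expPrimitive (-lam) (x - s) * c)
    (B' := fun x => Real.exp (-lam * (x - s)) * (-lam * 1) * dist (u s) v ^ 2
      + 2 * (Real.exp (-lam * (x - s)) * 1) * c)
    (l := -lam) (a := s) (b := s + h) (by linarith) (hu.continuousOn_dist_sq v hs) ?_
    (by simp) ?_ ?_
  · simpa using this
  · intro x hx
    refine (hu.rightSlopeLE hφ (hs.trans_le hx.1) hv).mono ?_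
    have := hu.antitoneOn hφ hlsc (hs.trans_le hx.1) (by simp only [mem_Ioi]; linarith) hx.2.le
    simp only at this
    linarith
  · intro x
    have h0 : HasDerivAt (fun x : ℝ => x - s) 1 x := (hasDerivAt_id x).sub_const s
    have h1 := (h0.const_mul (-lam)).exp
    have h2 : HasDerivAt (fun x => expPrimitive (-lam) (x - s))
        (Real.exp (-lam * (x - s)) * 1) x :=
      HasDerivAt.comp x (h₂ := expPrimitive (-lam)) (hasDerivAt_expPrimitive (-lam) (x - s)) h0
    exact (h1.mul_const _).add ((h2.const_mul 2).mul_const c)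
  · intro x _
    have := one_add_mul_expPrimitive (-lam) (x - s)
    apply le_of_eq
    linear_combination 2 * c * this

end EVIFlow

/-! ### Contraction, and trajectories from points of finite slope -/

namespace EVIFlow

open Filter Topology Set

variable {X : Type*} [MetricSpace X] {φ : X → EReal} {lam : ℝ}

theorem hasDerivAt_expPrimitive_sub (μ s x : ℝ) :
    HasDerivAt (fun x => expPrimitive μ (x - s)) (Real.exp (μ * (x - s))) x := by
  have h0 : HasDerivAt (fun x : ℝ => x - s) 1 x := (hasDerivAt_id x).sub_const s
  have h := HasDerivAt.comp x (h₂ := expPrimitive μ) (hasDerivAt_expPrimitive μ (x - s)) h0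
  rwa [mul_one] at h

theorem continuous_expPrimitive (μ : ℝ) : Continuous (expPrimitive μ) :=
  continuous_iff_continuousAt.2 fun x => (hasDerivAt_expPrimitive μ x).continuousAt

/-- Differential form of the contraction property, by doubling the variables. -/
theorem IsEVISolution.rightSlopeLE_dist_sq (hφ : ∀ x, φ x ≠ ⊥) (hlsc : LowerSemicontinuous φ)
    {u w : ℝ → X} (hu : IsEVISolution φ lam u) (hw : IsEVISolution φ lam w) {t : ℝ}
    (ht : 0 < t) :
    RightSlopeLE (fun s => dist (u s) (w s) ^ 2) t (0 + 2 * (-lam) * dist (u t) (w t) ^ 2) := by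
  intro r hr
  -- The energy error enters as `2 * ε`, that is, half of the available gap.
  set ε := (r - (0 + 2 * (-lam) * dist (u t) (w t) ^ 2)) / 4 with hε
  have hε0 : 0 < ε := by rw [hε]; linarith
  have hlow : ∀ᶠ z in 𝓝[>] t, (φ (u t)).toReal - ε < (φ (u z)).toReal :=
    nhdsWithin_le_nhds (hu.eventually_lt_toReal hφ hlsc ht (by linarith))
  have hK : Tendsto (fun z => (z - t)⁻¹ * expPrimitive (-lam) (z - t)) (𝓝[>] t) (𝓝 1) := by
    have h := (hasDerivAt_iff_tendsto_slope.1 (hasDerivAt_expPrimitive_sub (-lam) t t))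
    have h2 : Tendsto _ (𝓝[>] t) _ :=
      h.mono_left (nhdsWithin_mono t fun z hz => ne_of_gt (mem_Ioi.1 hz))
    refine Tendsto.congr (fun z => ?_) (by simpa using h2)
    simp [slope_def_field, div_eq_inv_mul]
  have hwc : Tendsto w (𝓝[>] t) (𝓝 (w t)) :=
    (hw.continuousOn.continuousAt (Ioi_mem_nhds ht)).mono_left nhdsWithin_le_nhds
  have hd : Tendsto (fun z => dist (u t) (w z) ^ 2) (𝓝[>] t) (𝓝 (dist (u t) (w t) ^ 2)) :=
    (tendsto_const_nhds.dist hwc).pow 2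
  have hlim : Tendsto (fun z => (z - t)⁻¹ * expPrimitive (-lam) (z - t) *
      (-lam * dist (u t) (w z) ^ 2 + -lam * dist (u t) (w t) ^ 2 + 2 * ε)) (𝓝[>] t)
      (𝓝 (1 * (-lam * dist (u t) (w t) ^ 2 + -lam * dist (u t) (w t) ^ 2 + 2 * ε))) :=
    hK.mul (((hd.const_mul _).add_const _).add_const _)
  have hlt : 1 * (-lam * dist (u t) (w t) ^ 2 + -lam * dist (u t) (w t) ^ 2 + 2 * ε) < r := by
    rw [hε]; linarith
  filter_upwards [hlow, hlim.eventually_lt_const hlt, self_mem_nhdsWithin] with z h1 h2 hz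
  refine lt_of_le_of_lt ?_ h2
  have hz' : 0 < z - t := sub_pos.2 (mem_Ioi.1 hz)
  have hz0 : 0 < z := ht.trans (mem_Ioi.1 hz)
  -- Only one variable moves in each estimate: `u` against the fixed `w z`, then `w` against the
  -- fixed `u t`. The energy of `w z` cancels in the sum, and the remaining drop of energy along `u`
  -- is below `ε`.
  have e1 := hu.dist_sq_le hφ hlsc ht hz'.le (hw.mem_dom z hz0)
  have e2 := hw.dist_sq_le hφ hlsc ht hz'.le (hu.mem_dom t ht)
  rw [add_sub_cancel] at e1 e2
  rw [dist_comm (w z), dist_comm (w t)] at e2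
  have hE := expPrimitive_nonneg (-lam) hz'.le
  rw [slope_def_field, div_eq_inv_mul, mul_assoc]
  refine mul_le_mul_of_nonneg_left ?_ (inv_nonneg.2 hz'.le)
  rw [← one_add_mul_expPrimitive] at e1 e2
  nlinarith [mul_le_mul_of_nonneg_left h1.le hE]

theorem IsEVISolution.dist_sq_le_exp (hφ : ∀ x, φ x ≠ ⊥) (hlsc : LowerSemicontinuous φ)
    {u w : ℝ → X} (hu : IsEVISolution φ lam u) (hw : IsEVISolution φ lam w) {s t : ℝ}
    (hs : 0 < s) (hst : s ≤ t) :
    dist (u t) (w t) ^ 2 ≤ Real.exp (2 * (-lam) * (t - s)) * dist (u s) (w s) ^ 2 := by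
  have hc : ∀ {u : ℝ → X}, IsEVISolution φ lam u → ContinuousOn u (Icc s t) := fun hu =>
    hu.continuousOn.mono fun x hx => lt_of_lt_of_le hs hx.1
  have hcu := hc hu
  have hcw := hc hw
  refine RightSlopeLE.le_of_linear (f := fun x => dist (u x) (w x) ^ 2) (κ := fun _ => 0)
    (B := fun x => Real.exp (2 * (-lam) * (x - s)) * dist (u s) (w s) ^ 2)
    (B' := fun x => Real.exp (2 * (-lam) * (x - s)) * (2 * (-lam) * 1) * dist (u s) (w s) ^ 2)
    (l := 2 * (-lam)) hst (by fun_prop)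
    (fun x hx => hu.rightSlopeLE_dist_sq hφ hlsc hw (hs.trans_le hx.1)) (by simp) ?_ ?_
  · intro x
    have h0 : HasDerivAt (fun x : ℝ => x - s) 1 x := (hasDerivAt_id x).sub_const s
    exact ((h0.const_mul (2 * (-lam))).exp).mul_const _
  · intro x _
    apply le_of_eq
    ring

variable {D : Set X} {S : ℝ → X → X}

/-- The integrated EVI from the initial time. -/
theorem IsEVIGradientFlow.dist_sq_le (hφ : ∀ x, φ x ≠ ⊥) (hlsc : LowerSemicontinuous φ)
    (hS : IsEVIGradientFlow φ lam D S) {x : X} (hx : x ∈ D) {t : ℝ} (ht : 0 < t) {v : X}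
    (hv : v ∈ dom φ) :
    dist (S t x) v ^ 2 ≤ Real.exp (-lam * t) * dist x v ^ 2
      + 2 * expPrimitive (-lam) t * ((φ v).toReal - (φ (S t x)).toReal) := by
  have hE := continuous_expPrimitive (-lam)
  have hid : Tendsto (fun s : ℝ => t - s) (𝓝[>] 0) (𝓝 (t - 0)) :=
    (Continuous.tendsto (by fun_prop) 0).mono_left nhdsWithin_le_nhds
  rw [sub_zero] at hid
  have hlim : Tendsto (fun s => Real.exp (-lam * (t - s)) * dist (S s x) v ^ 2
      + 2 * expPrimitive (-lam) (t - s) * ((φ v).toReal - (φ (S t x)).toReal)) (𝓝[>] 0)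
      (𝓝 (Real.exp (-lam * t) * dist x v ^ 2
      + 2 * expPrimitive (-lam) t * ((φ v).toReal - (φ (S t x)).toReal))) := by
    refine Tendsto.add (Tendsto.mul ?_ (((hS.tendsto_zero x hx).dist tendsto_const_nhds).pow 2))
      ((((hE.tendsto t).comp hid).const_mul 2).mul_const _)
    exact (Real.continuous_exp.tendsto _).comp (hid.const_mul _)
  refine ge_of_tendsto hlim ?_
  filter_upwards [Ioo_mem_nhdsGT ht] with s hs
  have := (hS.isEVISolution x hx).dist_sq_le hφ hlsc hs.1 (sub_nonneg.2 hs.2.le) hv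
  simpa using this

/-- Contraction property of EVI gradient flows. -/
theorem IsEVIGradientFlow.dist_le (hφ : ∀ x, φ x ≠ ⊥) (hlsc : LowerSemicontinuous φ)
    (hS : IsEVIGradientFlow φ lam D S) {x y : X} (hx : x ∈ D) (hy : y ∈ D) {t : ℝ}
    (ht : 0 ≤ t) : dist (S t x) (S t y) ≤ Real.exp (-lam * t) * dist x y := by
  rcases eq_or_lt_of_le ht with rfl | ht
  · simp [hS.zero x hx, hS.zero y hy]
  have hid : Tendsto (fun s : ℝ => t - s) (𝓝[>] 0) (𝓝 (t - 0)) :=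
    (Continuous.tendsto (by fun_prop) 0).mono_left nhdsWithin_le_nhds
  rw [sub_zero] at hid
  have hlim : Tendsto (fun s => Real.exp (2 * (-lam) * (t - s)) * dist (S s x) (S s y) ^ 2)
      (𝓝[>] 0) (𝓝 (Real.exp (2 * (-lam) * t) * dist x y ^ 2)) :=
    ((Real.continuous_exp.tendsto _).comp (hid.const_mul _)).mul
      (((hS.tendsto_zero x hx).dist (hS.tendsto_zero y hy)).pow 2)
  have hsq : dist (S t x) (S t y) ^ 2 ≤ Real.exp (2 * (-lam) * t) * dist x y ^ 2 := by
    refine ge_of_tendsto hlim ?_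
    filter_upwards [Ioo_mem_nhdsGT ht] with s hs
    exact (hS.isEVISolution x hx).dist_sq_le_exp hφ hlsc (hS.isEVISolution y hy) hs.1 hs.2.le
  refine abs_le_of_sq_le_sq' ?_ (by positivity) |>.2
  rwa [mul_pow, ← Real.exp_nat_mul, show ((2 : ℕ) : ℝ) * (-lam * t) = 2 * (-lam) * t by
    push_cast; ring]

/-- The trajectory from a point with finite global slope leaves it with speed at most the slope. -/
theorem IsEVIGradientFlow.dist_self_le (hφ : ∀ x, φ x ≠ ⊥)
    (hS : IsEVIGradientFlow φ lam D S) {x : X} (hx : x ∈ D ∩ dom φ) {G : ℝ} (hG : 0 ≤ G)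
    (hslope : ∀ v ∈ D ∩ dom φ,
      (φ x).toReal - (φ v).toReal ≤ G * dist x v + (-lam) / 2 * dist x v ^ 2)
    {t : ℝ} (ht : 0 < t) : dist (S t x) x ≤ G * expPrimitive (-lam) t := by
  have hsol := hS.isEVISolution x hx.1
  have hlim0 : Tendsto (fun s => dist (S s x) x) (𝓝[>] 0) (𝓝 0) := by
    simpa using (hS.tendsto_zero x hx.1).dist (tendsto_const_nhds (x := x))
  have key : ∀ ε : ℝ, 0 < ε →
      dist (S t x) x ≤ (G + ε) * expPrimitive (-lam) t + ε * Real.exp (-lam * t) := by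
    intro ε hε
    -- `b` solves `b' = (G + ε) + (-lam) b` with `b 0 = ε`. Its positivity makes the comparison of
    -- squares strict at contact and lets it start at a small positive time `δ`, the EVI being
    -- unavailable at zero.
    set b : ℝ → ℝ := fun s => (G + ε) * expPrimitive (-lam) s + ε * Real.exp (-lam * s) with hb
    have hbpos : ∀ s, 0 ≤ s → 0 < b s := fun s hs => by
      have := expPrimitive_nonneg (-lam) hs
      have := Real.exp_pos (-lam * s)
      simp only [hb]; positivity
    have hbc : Continuous b := by
      have := continuous_expPrimitive (-lam)
      simp only [hb]; fun_prop
    have hb0 : Tendsto b (𝓝[>] 0) (𝓝 (b 0)) := hbc.continuousAt.mono_left nhdsWithin_le_nhds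
    obtain ⟨δ, hδ, hδ0⟩ := ((hlim0.eventually_lt hb0 (hbpos 0 le_rfl)).and
      (Ioo_mem_nhdsGT ht)).exists
    have hb' : ∀ s, HasDerivAt b ((G + ε) * Real.exp (-lam * s)
        + ε * (Real.exp (-lam * s) * (-lam * 1))) s := fun s =>
      ((hasDerivAt_expPrimitive (-lam) s).const_mul _).add
        ((((hasDerivAt_id s).const_mul (-lam)).exp).const_mul ε)
    have hsq : dist (S t x) x ^ 2 ≤ b t ^ 2 := by
      refine RightSlopeLE.le_of_lt_deriv (f := fun s => dist (S s x) x ^ 2)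
        (B := fun s => b s ^ 2) (a := δ) hδ0.2.le (hsol.continuousOn_dist_sq x hδ0.1)
        (fun s hs => hsol.rightSlopeLE hφ (hδ0.1.trans_le hs.1) hx.2) ?_
        (fun s => (hb' s).pow 2) ?_
      · exact pow_le_pow_left₀ dist_nonneg hδ.le 2
      · intro s hs heq
        have hs0 : 0 < s := hδ0.1.trans_le hs.1
        have hbs := hbpos s hs0.le
        have hds : dist (S s x) x = b s := by
          have := (sq_eq_sq₀ dist_nonneg hbs.le).1 heq
          exact this
        have h1 := hslope (S s x) ⟨hS.mapsTo s hs0.le hx.1, hsol.mem_dom s hs0⟩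
        rw [dist_comm, hds] at h1
        rw [hds]
        have h2 := one_add_mul_expPrimitive (-lam) s
        have h3 : (G + ε) * Real.exp (-lam * s) + ε * (Real.exp (-lam * s) * (-lam * 1))
            = G + ε + (-lam) * b s := by
          simp only [hb]
          linear_combination (-(G + ε)) * h2
        rw [h3]
        push_cast
        nlinarith [mul_pos hε hbs]
    exact abs_le_of_sq_le_sq' hsq (hbpos t ht.le).le |>.2
  have hlim : Tendsto (fun ε : ℝ => (G + ε) * expPrimitive (-lam) t + ε * Real.exp (-lam * t))
      (𝓝[>] 0) (𝓝 ((G + 0) * expPrimitive (-lam) t + 0 * Real.exp (-lam * t))) :=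
    (Continuous.tendsto (by fun_prop) 0).mono_left nhdsWithin_le_nhds
  rw [add_zero, zero_mul, add_zero] at hlim
  exact ge_of_tendsto hlim (eventually_nhdsWithin_of_forall fun ε hε => key ε hε)

/-- Quadratic estimate of the distance of the flow from a competitor `v`, when the starting point
has finite global slope. -/
theorem IsEVIGradientFlow.dist_sq_le_of_slope (hφ : ∀ x, φ x ≠ ⊥) (hlam : lam ≤ 0)
    (hS : IsEVIGradientFlow φ lam D S) {x : X} (hx : x ∈ D ∩ dom φ) {G : ℝ} (hG : 0 ≤ G)
    (hslope : ∀ v ∈ D ∩ dom φ,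
      (φ x).toReal - (φ v).toReal ≤ G * dist x v + (-lam) / 2 * dist x v ^ 2)
    {t : ℝ} (ht : 0 < t) {v : X} (hv : v ∈ dom φ) :
    dist (S t x) v ^ 2 ≤ Real.exp (-lam * t) * dist x v ^ 2
      - 2 * expPrimitive (-lam) t * ((φ x).toReal - (φ v).toReal)
      + G ^ 2 * expPrimitive (-lam) t ^ 2 := by
  have hsol := hS.isEVISolution x hx.1
  set P := (φ x).toReal - (φ v).toReal with hP
  have key : ∀ ε : ℝ, 0 < ε → dist (S t x) v ^ 2 ≤ Real.exp (-lam * t) * (dist x v ^ 2 + ε)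
      - 2 * expPrimitive (-lam) t * P + G ^ 2 * expPrimitive (-lam) t ^ 2 := by
    intro ε hε
    set B : ℝ → ℝ := fun s => Real.exp (-lam * s) * (dist x v ^ 2 + ε)
      - 2 * expPrimitive (-lam) s * P + G ^ 2 * expPrimitive (-lam) s ^ 2 with hB
    have hBc : Continuous B := by
      have := continuous_expPrimitive (-lam)
      simp only [hB]; fun_prop
    have hB0 : Tendsto B (𝓝[>] 0) (𝓝 (B 0)) := hBc.continuousAt.mono_left nhdsWithin_le_nhds
    have hlim0 : Tendsto (fun s => dist (S s x) v ^ 2) (𝓝[>] 0) (𝓝 (dist x v ^ 2)) :=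
      ((hS.tendsto_zero x hx.1).dist tendsto_const_nhds).pow 2
    obtain ⟨δ, hδ, hδ0⟩ := ((hlim0.eventually_lt hB0 (by simp [hB, hε])).and
      (Ioo_mem_nhdsGT ht)).exists
    -- The EVI energy term is split at `φ x`: the part between `x` and `S s x` is bounded by the
    -- slope and `dist_self_le`, giving `κ`. The term `G ^ 2 * E ^ 2` solves the resulting equation
    -- exactly, by `E' = 1 + (-lam) E`.
    refine RightSlopeLE.le_of_linear (f := fun s => dist (S s x) v ^ 2)
      (κ := fun s => -2 * P + 2 * G ^ 2 * (expPrimitive (-lam) s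
        + (-lam) / 2 * expPrimitive (-lam) s ^ 2)) (l := -lam)
      (B := B) (B' := fun s => Real.exp (-lam * s) * (-lam * 1) * (dist x v ^ 2 + ε)
        - 2 * Real.exp (-lam * s) * P
        + G ^ 2 * (((2 : ℕ) : ℝ) * expPrimitive (-lam) s ^ (2 - 1) * Real.exp (-lam * s)))
      (a := δ) hδ0.2.le (hsol.continuousOn_dist_sq v hδ0.1) ?_ hδ.le ?_ ?_
    · intro s hs
      have hs0 : 0 < s := hδ0.1.trans_le hs.1
      refine (hsol.rightSlopeLE hφ hs0 hv).mono ?_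
      have h1 := hslope (S s x) ⟨hS.mapsTo s hs0.le hx.1, hsol.mem_dom s hs0⟩
      have h2 := hS.dist_self_le hφ hx hG hslope hs0
      rw [dist_comm] at h2
      have hE := expPrimitive_nonneg (-lam) hs0.le
      have h3 : G * dist x (S s x) ≤ G * (G * expPrimitive (-lam) s) :=
        mul_le_mul_of_nonneg_left h2 hG
      have h4 : (-lam) / 2 * dist x (S s x) ^ 2 ≤ (-lam) / 2 * (G * expPrimitive (-lam) s) ^ 2 :=
        mul_le_mul_of_nonneg_left (pow_le_pow_left₀ dist_nonneg h2 2) (by linarith)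
      rw [hP]
      nlinarith
    · intro s
      have hE := hasDerivAt_expPrimitive (-lam) s
      exact (((((hasDerivAt_id s).const_mul (-lam)).exp).mul_const _).sub
        ((hE.const_mul 2).mul_const P)).add ((hE.pow 2).const_mul _)
    · intro s _
      have h := one_add_mul_expPrimitive (-lam) s
      apply le_of_eq
      simp only [hB]
      push_cast
      linear_combination (-2 * P + 2 * G ^ 2 * expPrimitive (-lam) s) * h
  have hlim : Tendsto (fun ε : ℝ => Real.exp (-lam * t) * (dist x v ^ 2 + ε)
      - 2 * expPrimitive (-lam) t * P + G ^ 2 * expPrimitive (-lam) t ^ 2)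
      (𝓝[>] 0) (𝓝 (Real.exp (-lam * t) * (dist x v ^ 2 + 0)
      - 2 * expPrimitive (-lam) t * P + G ^ 2 * expPrimitive (-lam) t ^ 2)) :=
    (Continuous.tendsto (by fun_prop) 0).mono_left nhdsWithin_le_nhds
  rw [add_zero] at hlim
  exact ge_of_tendsto hlim (eventually_nhdsWithin_of_forall fun ε hε => key ε hε)

end EVIFlow

/-! ### Approximate convexity and resolvent points -/

namespace EVIFlow

open Filter Topology Set

theorem le_of_forall_le_of_continuous {c : ℝ} {g : ℝ → ℝ} (hg : Continuous g)
    (h : ∀ ε ∈ Ioo (0 : ℝ) 1, c ≤ g ε) : c ≤ g 0 :=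
  ge_of_tendsto (hg.continuousAt.mono_left nhdsWithin_le_nhds)
    (by filter_upwards [Ioo_mem_nhdsGT (zero_lt_one (α := ℝ))] with ε hε using h ε hε)

/-- After `exp x ≥ 1 + x` the claim reads `y / 5 ≥ 6 / 5 * y ^ 2`, so the rate `6 / 5` matches the
bound `1 / 6`. -/
theorem one_le_one_sub_mul_exp {y : ℝ} (h0 : 0 ≤ y) (h6 : y ≤ 1 / 6) :
    1 ≤ (1 - y) * Real.exp (6 / 5 * y) := by
  have h := mul_le_mul_of_nonneg_left (Real.add_one_le_exp (6 / 5 * y))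
    (by linarith : 0 ≤ 1 - y)
  nlinarith

variable {X : Type*} [MetricSpace X] {φ : X → EReal} {lam τ η : ℝ} {D : Set X}

/-- The weighted sum of squares equals `(a + b) ^ 2` plus a multiple of `(a - θ (a + b)) ^ 2`; since
`d ≤ a + b`, the slack controls both the excess length and the deviation from the ratio `θ`. In the
second bound the error carries a factor `θ`, so that it still vanishes after division by `θ = ε`. -/
theorem IsIntermediatePoint.bounds {θ ε : ℝ} {x₀ x₁ x : X} (hθ : θ ∈ Ioo (0 : ℝ) 1)
    (hε : ε ∈ Ioo (0 : ℝ) 1) (h : IsIntermediatePoint θ ε x₀ x₁ x) :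
    dist x₀ x ≤ θ * dist x₀ x₁ * (1 + 2 * ε) ∧
      dist x x₁ ^ 2 ≤ (1 - θ) * dist x₀ x₁ ^ 2 * (1 - θ + 2 * ε * θ) := by
  obtain ⟨h0, h1⟩ := hθ
  obtain ⟨e0, e1⟩ := hε
  have h1' : 0 < 1 - θ := sub_pos.2 h1
  unfold IsIntermediatePoint at h
  have htri := dist_triangle x₀ x x₁
  set d := dist x₀ x₁
  set a := dist x₀ x
  set b := dist x x₁
  have hd : 0 ≤ d := dist_nonneg
  have hab : a ^ 2 / θ + b ^ 2 / (1 - θ)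
      = (a + b) ^ 2 + (a - θ * (a + b)) ^ 2 / (θ * (1 - θ)) := by
    field_simp
    ring
  rw [hab] at h
  have hsd : d ^ 2 ≤ (a + b) ^ 2 := pow_le_pow_left₀ hd htri 2
  have hθθ : 0 < θ * (1 - θ) := mul_pos h0 h1'
  have hc : (a - θ * (a + b)) ^ 2 ≤ (ε * θ * (1 - θ) * d) ^ 2 := by
    have : (a - θ * (a + b)) ^ 2 / (θ * (1 - θ)) ≤ d ^ 2 * (ε ^ 2 * θ * (1 - θ)) := by linarith
    rw [div_le_iff₀ hθθ] at this
    linarith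
  have hc2 := abs_le_of_sq_le_sq' hc (by positivity)
  have hs : a + b ≤ d * (1 + ε) := by
    refine abs_le_of_sq_le_sq' ?_ (by positivity) |>.2
    have h3 : 0 ≤ (a - θ * (a + b)) ^ 2 / (θ * (1 - θ)) := by positivity
    have h4 : θ * (1 - θ) ≤ 1 := by nlinarith
    have h5 : ε ^ 2 * (θ * (1 - θ)) ≤ ε ^ 2 * 1 := mul_le_mul_of_nonneg_left h4 (sq_nonneg _)
    have h6 : d ^ 2 * (1 + ε ^ 2 * θ * (1 - θ)) ≤ d ^ 2 * (1 + ε) ^ 2 :=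
      mul_le_mul_of_nonneg_left (by nlinarith) (sq_nonneg _)
    rw [mul_pow]
    linarith
  have hεd : 0 ≤ ε * d := by positivity
  constructor
  · have h3 : ε * θ * (1 - θ) * d ≤ ε * θ * d := by
      nlinarith [mul_nonneg hεd (mul_pos h0 h0).le]
    nlinarith [mul_le_mul_of_nonneg_left hs h0.le]
  -- Bounding `b` as `a` was bounded would lose that factor `θ`; instead a lower bound for `a` is
  -- subtracted from the total.
  · have ha : θ * (1 - ε) * d ≤ a := by
      nlinarith [mul_nonneg hεd (mul_pos h0 h0).le, mul_le_mul_of_nonneg_left htri h0.le]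
    have ha2 : (θ * (1 - ε) * d) ^ 2 ≤ a ^ 2 :=
      pow_le_pow_left₀ (mul_nonneg (mul_nonneg h0.le (by linarith)) hd) ha 2
    have h4 : b ^ 2 / (1 - θ) ≤ d ^ 2 * (1 - θ + 2 * ε * θ) := by
      have h5 : θ * (1 - ε) ^ 2 * d ^ 2 ≤ a ^ 2 / θ := by
        rw [le_div_iff₀ h0]
        linarith
      have h6 : d ^ 2 * (1 + ε ^ 2 * θ * (1 - θ)) - θ * (1 - ε) ^ 2 * d ^ 2
          = d ^ 2 * (1 - θ + 2 * ε * θ) - d ^ 2 * ε ^ 2 * θ ^ 2 := by ring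
      have h7 : 0 ≤ d ^ 2 * ε ^ 2 * θ ^ 2 := by positivity
      linarith
    rw [div_le_iff₀ h1'] at h4
    linarith

/-- The convexity inequality itself puts the point in the domain. Membership in `D` is dropped
because minimality is tested against all of `X`. -/
theorem ApproxConvexIn.exists_toReal_le (hφ : ∀ x, φ x ≠ ⊥) (hconv : ApproxConvexIn φ lam D)
    {x₀ x₁ : X} (h₀ : x₀ ∈ D ∩ dom φ) (h₁ : x₁ ∈ D ∩ dom φ) {θ ε : ℝ}
    (hθ : θ ∈ Ioo (0 : ℝ) 1) (hε : ε ∈ Ioo (0 : ℝ) 1) :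
    ∃ x ∈ dom φ, dist x₀ x ≤ θ * dist x₀ x₁ * (1 + 2 * ε) ∧
      dist x x₁ ^ 2 ≤ (1 - θ) * dist x₀ x₁ ^ 2 * (1 - θ + 2 * ε * θ) ∧
      (φ x).toReal ≤ (1 - θ) * (φ x₀).toReal + θ * (φ x₁).toReal
        - (lam - ε) / 2 * θ * (1 - θ) * dist x₀ x₁ ^ 2 := by
  obtain ⟨x, -, hx, hle⟩ := hconv x₀ h₀ x₁ h₁ θ hθ ε hε
  rw [← coe_toReal_of_mem_dom hφ h₀.2, ← coe_toReal_of_mem_dom hφ h₁.2, ← EReal.coe_mul,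
    ← EReal.coe_mul, ← EReal.coe_add, ← EReal.coe_sub] at hle
  have hxd : x ∈ dom φ := lt_of_le_of_lt hle (EReal.coe_lt_top _)
  rw [← coe_toReal_of_mem_dom hφ hxd, EReal.coe_le_coe_iff] at hle
  exact ⟨x, hxd, (hx.bounds hθ hε).1, (hx.bounds hθ hε).2, hle⟩

theorem toReal_le_of_mem_resolvent (hφ : ∀ x, φ x ≠ ⊥) {w z y : X} (hz : z ∈ resolvent φ τ η w)
    (hy : y ∈ dom φ) :
    1 / (2 * τ) * dist w z ^ 2 + (φ z).toReal ≤
      1 / (2 * τ) * dist w y ^ 2 + (φ y).toReal + η / 2 * dist w z * dist y z := by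
  have h := hz.2.1 y
  rw [← coe_toReal_of_mem_dom hφ hz.1, ← coe_toReal_of_mem_dom hφ hy] at h
  exact_mod_cast h

theorem dist_sq_le_of_mem_resolvent (hφ : ∀ x, φ x ≠ ⊥) (hτ : 0 < τ) {w z : X}
    (hw : w ∈ dom φ) (hz : z ∈ resolvent φ τ η w) :
    dist w z ^ 2 ≤ 2 * τ * ((φ w).toReal - (φ z).toReal) := by
  have h := hz.2.2
  rw [← coe_toReal_of_mem_dom hφ hz.1, ← coe_toReal_of_mem_dom hφ hw] at h
  have h2 : 1 / (2 * τ) * dist w z ^ 2 + (φ z).toReal ≤ (φ w).toReal := by exact_mod_cast h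
  have h3 : dist w z ^ 2 / (2 * τ) ≤ (φ w).toReal - (φ z).toReal := by
    rw [div_eq_inv_mul, ← one_div]; linarith
  rw [div_le_iff₀ (by positivity)] at h3
  linarith

/-- Along geodesic-like competitors, points of the resolvent have finite global slope. -/
theorem toReal_sub_le_of_mem_resolvent (hφ : ∀ x, φ x ≠ ⊥) (hconv : ApproxConvexIn φ lam D)
    (hτ : 0 < τ) (hη : 0 ≤ η) {w z : X} (hzD : z ∈ D) (hz : z ∈ resolvent φ τ η w) {v : X}
    (hv : v ∈ D ∩ dom φ) :
    (φ z).toReal - (φ v).toReal ≤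
      (1 / τ + η / 2) * dist w z * dist z v + (-lam) / 2 * dist z v ^ 2 := by
  set d := dist w z
  set H := dist z v
  have hd : 0 ≤ d := dist_nonneg
  have hH : 0 ≤ H := dist_nonneg
  have key := le_of_forall_le_of_continuous (c := (φ z).toReal - (φ v).toReal)
    (g := fun ε => (1 / τ + η / 2) * (d * (H * (1 + 2 * ε)))
      + ε * (H * (1 + 2 * ε)) ^ 2 / (2 * τ) - (lam - ε) / 2 * (1 - ε) * H ^ 2)
    (by fun_prop) ?_
  · simp only [zero_mul, mul_zero, add_zero, sub_zero, mul_one, zero_div] at key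
    linarith
  intro ε hε
  -- First variation of the minimality of `z` towards `v`: `ε` is both the interpolation parameter
  -- and the tolerance, so dividing by `ε` and letting it vanish removes both errors.
  obtain ⟨x, hx, h1, -, h2⟩ := hconv.exists_toReal_le hφ ⟨hzD, hz.1⟩ hv hε hε
  have h3 := toReal_le_of_mem_resolvent hφ hz hx
  have h4 := dist_triangle w z x
  rw [dist_comm x z] at h3
  set a := dist z x
  have ha : 0 ≤ a := dist_nonneg
  have h5 : dist w x ^ 2 ≤ (d + a) ^ 2 := pow_le_pow_left₀ dist_nonneg h4 2
  have h6 : 1 / (2 * τ) * dist w x ^ 2 ≤ 1 / (2 * τ) * (d + a) ^ 2 :=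
    mul_le_mul_of_nonneg_left h5 (by positivity)
  have h7 : (1 / τ + η / 2) * (d * a) ≤ (1 / τ + η / 2) * (d * (ε * H * (1 + 2 * ε))) := by
    gcongr
  have h8 : 1 / (2 * τ) * a ^ 2 ≤ 1 / (2 * τ) * (ε * H * (1 + 2 * ε)) ^ 2 := by
    gcongr
  have h9 : 1 / (2 * τ) * (d + a) ^ 2
      = 1 / (2 * τ) * d ^ 2 + 1 / τ * (d * a) + 1 / (2 * τ) * a ^ 2 := by
    field_simp; ring
  have h10 : ε * ((φ z).toReal - (φ v).toReal) ≤
      ε * ((1 / τ + η / 2) * (d * (H * (1 + 2 * ε)))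
      + ε * (H * (1 + 2 * ε)) ^ 2 / (2 * τ) - (lam - ε) / 2 * (1 - ε) * H ^ 2) := by
    have e1 : 1 / (2 * τ) * (ε * H * (1 + 2 * ε)) ^ 2
        = ε * (ε * (H * (1 + 2 * ε)) ^ 2 / (2 * τ)) := by ring
    rw [e1] at h8
    linarith
  exact le_of_mul_le_mul_left h10 hε.1

/-- The energy drop in one minimizing step controls the full squared displacement. -/
theorem dist_sq_div_le_of_mem_resolvent (hφ : ∀ x, φ x ≠ ⊥) (hconv : ApproxConvexIn φ lam D)
    (hτ : 0 < τ) (hη : 0 ≤ η) {w z : X} (hw : w ∈ D ∩ dom φ) (hzD : z ∈ D)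
    (hz : z ∈ resolvent φ τ η w) :
    dist w z ^ 2 / τ ≤ (φ w).toReal - (φ z).toReal + (η - lam) / 2 * dist w z ^ 2 := by
  set d := dist w z with hdd
  have hd : 0 ≤ d := dist_nonneg
  suffices h : (0 : ℝ) ≤ (φ w).toReal - (φ z).toReal + (η - lam) / 2 * d ^ 2 - d ^ 2 / τ by
    linarith
  have key := le_of_forall_le_of_continuous (c := 0)
    (g := fun ε => (φ w).toReal - (φ z).toReal - (lam - ε) / 2 * (1 - ε) * d ^ 2
      + η / 2 * d ^ 2 * (1 + 2 * ε) - d ^ 2 * (2 - ε - 2 * ε * (1 - ε)) / (2 * τ))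
    (by fun_prop) ?_
  · simp only [mul_zero, add_zero, sub_zero, mul_one] at key
    have e : d ^ 2 * 2 / (2 * τ) = d ^ 2 / τ := by field_simp
    rw [e] at key
    linarith
  intro ε hε
  -- The competitor moves from `z` back towards `w`. The first variation of the quadratic term
  -- yields `d ^ 2 / τ`, twice what comparison with `w` itself gives.
  obtain ⟨x, hx, h1, h1', h2⟩ := hconv.exists_toReal_le hφ ⟨hzD, hz.1⟩ hw hε hε
  have h3 := toReal_le_of_mem_resolvent hφ hz hx
  rw [dist_comm x z, dist_comm w x, ← hdd] at h3
  rw [dist_comm z w, ← hdd] at h1 h1' h2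
  have h7 : η / 2 * d * dist z x ≤ η / 2 * d * (ε * d * (1 + 2 * ε)) := by gcongr
  have h8 : 1 / (2 * τ) * dist x w ^ 2 ≤
      1 / (2 * τ) * ((1 - ε) * d ^ 2 * (1 - ε + 2 * ε * ε)) := by gcongr
  have h10 : ε * 0 ≤ ε * ((φ w).toReal - (φ z).toReal - (lam - ε) / 2 * (1 - ε) * d ^ 2
      + η / 2 * d ^ 2 * (1 + 2 * ε) - d ^ 2 * (2 - ε - 2 * ε * (1 - ε)) / (2 * τ)) := by
    have e1 : ε * (d ^ 2 * (2 - ε - 2 * ε * (1 - ε)) / (2 * τ))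
        = 1 / (2 * τ) * d ^ 2 - 1 / (2 * τ) * ((1 - ε) * d ^ 2 * (1 - ε + 2 * ε * ε)) := by
      ring
    rw [mul_zero, mul_sub, e1]
    linarith
  exact le_of_mul_le_mul_left h10 hε.1

/-! ### Local error -/

variable {S : ℝ → X → X} {γ : ℝ}

/-- Local error of one minimizing step against the flow. -/
theorem IsEVIGradientFlow.dist_sq_step_le (hφ : ∀ x, φ x ≠ ⊥) (hlam : lam ≤ 0)
    (hS : IsEVIGradientFlow φ lam D S) (hconv : ApproxConvexIn φ lam D) (hτ : 0 < τ)
    (hη : 0 ≤ η) (hγ : γ = 2 * η - 3 * lam) (hγτ : 4 * γ * τ ≤ 1) {w z z' : X}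
    (hz : z ∈ resolvent φ τ η w) (hzD : z ∈ D) (hz' : z' ∈ resolvent φ τ η z)
    (hzD' : z' ∈ D) :
    dist (S τ z) z' ^ 2 ≤ Real.exp (6 / 5 * γ * τ) * dist w z ^ 2 - dist z z' ^ 2 := by
  set l := -lam with hl
  have hl0 : 0 ≤ l := by linarith
  set d := dist w z
  set d' := dist z z'
  have hd : 0 ≤ d := dist_nonneg
  have hW := hS.dist_sq_le_of_slope hφ hlam ⟨hzD, hz.1⟩
    (G := (1 / τ + η / 2) * d) (by positivity)
    (fun v hv => toReal_sub_le_of_mem_resolvent hφ hconv hτ hη hzD hz hv) hτ hz'.1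
  have hP := dist_sq_div_le_of_mem_resolvent hφ hconv hτ hη ⟨hzD, hz.1⟩ hzD' hz'
  rw [← hl] at hW
  set P := (φ z).toReal - (φ z').toReal
  obtain ⟨e, he⟩ : ∃ e, expPrimitive l τ = τ * e := ⟨expPrimitive l τ / τ, by field_simp⟩
  have he1 : 1 ≤ e := by
    have := le_expPrimitive hl0 hτ.le
    rw [he] at this
    exact le_of_mul_le_mul_left (by linarith) hτ
  have he2 : e ≤ Real.exp (l * τ) := by
    have := expPrimitive_le_mul_exp hl0 hτ.le
    rw [he] at this
    exact le_of_mul_le_mul_left this hτ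
  have hexp : Real.exp (l * τ) = 1 + l * (τ * e) := by rw [← he, one_add_mul_expPrimitive]
  -- Inserting `hP'` and `hexp` into `hW` gives `d' ^ 2` the coefficient `1 - e * (2 - y)`, at most
  -- `-e * (1 - y)` since `1 ≤ e`.
  set y := 2 * l * τ + η * τ with hy
  have hlτ : 0 ≤ l * τ := by positivity
  have hητ : 0 ≤ η * τ := by positivity
  have hy0 : 0 ≤ y := by rw [hy]; linarith
  have hγ' : γ * τ = 2 * (η * τ) + 3 * (l * τ) := by rw [hγ, hl]; ring
  have hy6 : y ≤ 1 / 6 := by rw [hy]; linarith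
  have hP' : (2 - (l + η) * τ) * d' ^ 2 ≤ 2 * τ * P := by
    have h1 : τ * (d' ^ 2 / τ) = d' ^ 2 := by field_simp
    have h2 := mul_le_mul_of_nonneg_left hP hτ.le
    rw [h1] at h2
    have h3 : η - lam = l + η := by rw [hl]; ring
    rw [h3] at h2
    linarith
  have hP2 := mul_le_mul_of_nonneg_left hP' (by linarith : 0 ≤ e)
  have hG : ((1 / τ + η / 2) * d) ^ 2 * (τ * e) ^ 2 = e ^ 2 * (1 + η * τ / 2) ^ 2 * d ^ 2 := by
    field_simp
  rw [he, hG, hexp] at hW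
  have hd'2 : 0 ≤ d' ^ 2 := sq_nonneg _
  have hm : 0 < e * (1 - y) := mul_pos (by linarith) (by linarith)
  -- The total exponent is `17/5 * l τ + 11/5 * η τ`, just below `6/5 * γ τ = 18/5 * l τ + 12/5 * η
  -- τ`.
  have hq : e * (1 + η * τ / 2) ^ 2 ≤ (1 - y) * Real.exp (6 / 5 * γ * τ) := by
    have h1 : (1 + η * τ / 2) ^ 2 ≤ Real.exp (η * τ / 2) ^ 2 :=
      pow_le_pow_left₀ (by positivity) (by linarith [Real.add_one_le_exp (η * τ / 2)]) 2
    have h2 : 1 ≤ (1 - y) * Real.exp (6 / 5 * y) := one_le_one_sub_mul_exp hy0 hy6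
    calc e * (1 + η * τ / 2) ^ 2 ≤ Real.exp (l * τ) * Real.exp (η * τ / 2) ^ 2 := by gcongr
      _ ≤ (Real.exp (l * τ) * Real.exp (η * τ / 2) ^ 2) * ((1 - y) * Real.exp (6 / 5 * y)) :=
        le_mul_of_one_le_right (by positivity) h2
      _ = (1 - y) * Real.exp (l * τ + (η * τ / 2 + η * τ / 2) + 6 / 5 * y) := by
        rw [Real.exp_add, Real.exp_add, Real.exp_add]; ring
      _ ≤ (1 - y) * Real.exp (6 / 5 * γ * τ) := by
        refine mul_le_mul_of_nonneg_left (Real.exp_le_exp.2 ?_) (by linarith)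
        rw [hy]
        linarith
  have hm1 : e * (1 - y) ≤ 1 := by
    have h1 : 1 - y ≤ Real.exp (-(l * τ)) := by
      have := Real.add_one_le_exp (-(l * τ))
      rw [hy]; linarith
    calc e * (1 - y) ≤ Real.exp (l * τ) * Real.exp (-(l * τ)) :=
        mul_le_mul he2 h1 (by linarith) (Real.exp_pos _).le
      _ = 1 := by rw [← Real.exp_add]; simp
  have hmain : dist (S τ z) z' ^ 2 ≤
      e * (1 - y) * (Real.exp (6 / 5 * γ * τ) * d ^ 2 - d' ^ 2) := by
    have h1 : e ^ 2 * (1 + η * τ / 2) ^ 2 * d ^ 2 ≤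
        e * ((1 - y) * Real.exp (6 / 5 * γ * τ)) * d ^ 2 := by
      have := mul_le_mul_of_nonneg_left hq (by linarith : 0 ≤ e)
      have := mul_le_mul_of_nonneg_right this (sq_nonneg d)
      linarith
    have h2 := mul_le_mul_of_nonneg_right he1 hd'2
    rw [hy] at h1 ⊢
    linarith
  -- The sign is free, as a square stands on the left of `hmain`; this allows the factor `e * (1 -
  -- y) ≤ 1` to be dropped.
  have hpos : 0 ≤ Real.exp (6 / 5 * γ * τ) * d ^ 2 - d' ^ 2 := by
    have := (sq_nonneg (dist (S τ z) z')).trans hmain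
    exact nonneg_of_mul_nonneg_right this hm
  exact hmain.trans (mul_le_of_le_one_left hpos hm1)

end EVIFlow

/-! ### Accumulation of errors and numerical constants -/

namespace EVIFlow

open Filter Topology Set

/-- Induction step of Cauchy-Schwarz for a sum of square roots. -/
theorem sqrt_mul_add_sqrt_le (n : ℕ) {x y : ℝ} (hx : 0 ≤ x) (hy : 0 ≤ y) :
    √(n * x) + √y ≤ √((n + 1) * (x + y)) := by
  have hn : (0 : ℝ) ≤ n := n.cast_nonneg
  refine Real.le_sqrt_of_sq_le ?_
  have h1 := Real.sq_sqrt (mul_nonneg hn hx)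
  have h2 := Real.sq_sqrt hy
  have h3 : √(n * x) * √y = √x * √(n * y) := by
    rw [← Real.sqrt_mul (mul_nonneg hn hx), ← Real.sqrt_mul hx]
    congr 1
    ring
  have h4 := Real.sq_sqrt hx
  have h5 := Real.sq_sqrt (mul_nonneg hn hy)
  nlinarith [sq_nonneg (√x - √(n * y))]

/-- Accumulation of local errors whose squares telescope up to a growth factor. -/
theorem le_of_telescoping_recursion {e w c : ℕ → ℝ} {A R : ℝ} (hA : 1 ≤ A) (hR : 1 ≤ R)
    (he : ∀ i, e (i + 1) ≤ A * e i + w i) (hc : ∀ i, 0 ≤ c i)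
    (hw : ∀ i, w i ^ 2 ≤ R ^ 2 * c i - c (i + 1)) (n : ℕ) :
    e n ≤ A ^ n * e 0 + (A * R) ^ n * √(n * c 0) := by
  have hR0 : 0 < R := by linarith
  -- Rescaling absorbs the growth factor, so the bounds on `w i ^ 2` become true differences;
  -- nonnegativity of squares makes `b` antitone.
  set b : ℕ → ℝ := fun i => c i / R ^ (2 * i) with hb
  have hwb : ∀ i, R ^ 2 * c i - c (i + 1) = R ^ (2 * (i + 1)) * (b i - b (i + 1)) := by
    intro i
    simp only [hb]
    field_simp
    ring
  have hb1 : ∀ i, b (i + 1) ≤ b i := by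
    intro i
    have h := (sq_nonneg _).trans (hw i)
    rw [hwb] at h
    linarith [nonneg_of_mul_nonneg_right h (by positivity)]
  have hanti : Antitone b := antitone_nat_of_succ_le hb1
  have hwle : ∀ i, w i ≤ R ^ (i + 1) * √(b i - b (i + 1)) := by
    intro i
    refine abs_le_of_sq_le_sq' ?_ (by positivity) |>.2
    rw [mul_pow, Real.sq_sqrt (sub_nonneg.2 (hb1 i)), ← pow_mul, mul_comm (i + 1) 2, ← hwb]
    exact hw i
  have key : ∀ n : ℕ, e n ≤ A ^ n * e 0 + (A * R) ^ n * √(n * (b 0 - b n)) := by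
    intro n
    induction n with
    | zero => simp
    | succ n ih =>
      have h0 : 0 ≤ b 0 - b n := sub_nonneg.2 (hanti n.zero_le)
      have h1 : 0 ≤ b n - b (n + 1) := sub_nonneg.2 (hb1 n)
      have h2 := sqrt_mul_add_sqrt_le n h0 h1
      rw [sub_add_sub_cancel] at h2
      have h3 : A * (A * R) ^ n ≤ (A * R) ^ (n + 1) := by
        rw [pow_succ, mul_comm]
        exact mul_le_mul_of_nonneg_left (le_mul_of_one_le_right (by linarith) hR) (by positivity)
      have h4 : R ^ (n + 1) ≤ (A * R) ^ (n + 1) :=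
        pow_le_pow_left₀ hR0.le (le_mul_of_one_le_left hR0.le hA) _
      calc e (n + 1) ≤ A * e n + w n := he n
        _ ≤ A * (A ^ n * e 0 + (A * R) ^ n * √(n * (b 0 - b n)))
            + R ^ (n + 1) * √(b n - b (n + 1)) := by
          gcongr
          exact hwle n
        _ = A ^ (n + 1) * e 0 + (A * (A * R) ^ n * √(n * (b 0 - b n))
            + R ^ (n + 1) * √(b n - b (n + 1))) := by ring
        _ ≤ A ^ (n + 1) * e 0 + ((A * R) ^ (n + 1) * √(n * (b 0 - b n))
            + (A * R) ^ (n + 1) * √(b n - b (n + 1))) := by gcongr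
        _ ≤ A ^ (n + 1) * e 0 + (A * R) ^ (n + 1) * √((n + 1) * (b 0 - b (n + 1))) := by
          rw [← mul_add]
          gcongr
        _ = _ := by push_cast; rfl
  refine (key n).trans ?_
  have hb0 : b 0 = c 0 := by simp [hb]
  have hbn : 0 ≤ b n := div_nonneg (hc n) (by positivity)
  gcongr
  linarith

/-- An almost decreasing sequence is bounded by its averages. -/
theorem mul_le_pow_mul_sum {c : ℕ → ℝ} {Q : ℝ} (hQ : 1 ≤ Q) (hc0 : ∀ i, 0 ≤ c i)
    (hc : ∀ i, c (i + 1) ≤ Q * c i) (j : ℕ) :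
    (j + 1) * c j ≤ Q ^ j * ∑ i ∈ Finset.range (j + 1), c i := by
  have hle : ∀ i ∈ Finset.range (j + 1), c j ≤ Q ^ j * c i := by
    intro i hi
    obtain ⟨n, rfl⟩ := Nat.exists_eq_add_of_le (Nat.lt_succ_iff.1 (Finset.mem_range.1 hi))
    have h1 : ∀ n, c (i + n) ≤ Q ^ n * c i := by
      intro n
      induction n with
      | zero => simp
      | succ n ih =>
        calc c (i + n + 1) ≤ Q * c (i + n) := hc _
          _ ≤ Q * (Q ^ n * c i) := by gcongr
          _ = Q ^ (n + 1) * c i := by ring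
    exact (h1 n).trans (mul_le_mul_of_nonneg_right
      (pow_le_pow_right₀ hQ (Nat.le_add_left n i)) (hc0 i))
  have := Finset.sum_le_sum hle
  rw [← Finset.mul_sum] at this
  simpa using this

/-- Choice of the number of initial steps spent to regularize the initial datum. -/
theorem exists_initial_steps {τ γ r : ℝ} (hτ : 0 < τ) (hγ : 0 ≤ γ) (hγτ : 4 * γ * τ ≤ 1)
    {N : ℕ} (hN : 1 ≤ N) (hr : 0 ≤ r) (hr2 : r ^ 2 = τ * (N * τ)) :
    ∃ j : ℕ, j + 1 ≤ N ∧ ((j + 1 : ℕ) : ℝ) * τ ≤ r ∧ 4 * γ * (((j + 1 : ℕ) : ℝ) * τ) ≤ 1 ∧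
      r ≤ 2 * (((j + 1 : ℕ) : ℝ) * τ) * (1 + 4 * γ * r) := by
  have hγr : 0 ≤ γ * r := mul_nonneg hγ hr
  have h1 : 0 < 1 + 4 * γ * r := by linarith
  have hN' : (1 : ℝ) ≤ N := by exact_mod_cast hN
  have hτr : τ ≤ r := by
    refine abs_le_of_sq_le_sq' ?_ hr |>.2
    rw [hr2]
    nlinarith [mul_pos hτ hτ]
  have hle : ∀ k : ℕ, (k : ℝ) * τ ≤ r → k ≤ N := by
    intro k hk
    have h2 : ((k : ℝ) * τ) ^ 2 ≤ r ^ 2 := pow_le_pow_left₀ (by positivity) hk 2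
    rw [hr2] at h2
    have h3 : (k : ℝ) ^ 2 * (τ * τ) ≤ N * (τ * τ) := by linarith
    have h4 : k ^ 2 ≤ N := by exact_mod_cast le_of_mul_le_mul_right h3 (mul_pos hτ hτ)
    nlinarith
  -- `ρ` is at most `r` and satisfies `4 * γ * ρ ≤ 1`. Rounding down to the grid loses at most a
  -- factor `2`; if `ρ < τ`, a single step suffices.
  set ρ := r / (1 + 4 * γ * r) with hρ
  have hρr : ρ * (1 + 4 * γ * r) = r := div_mul_cancel₀ r h1.ne'
  have hρ0 : 0 ≤ ρ := div_nonneg hr h1.le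
  rcases lt_or_ge (ρ / τ) 1 with hq | hq
  · rw [div_lt_one hτ] at hq
    refine ⟨0, by simpa using hN, by simpa using hτr, by simpa using hγτ, ?_⟩
    have := mul_le_mul_of_nonneg_right hq.le h1.le
    rw [hρr] at this
    have h2 : 0 ≤ τ * (1 + 4 * γ * r) := by positivity
    push_cast
    linarith
  · obtain ⟨j, hj⟩ := Nat.exists_eq_succ_of_ne_zero
      (Nat.pos_iff_ne_zero.1 (Nat.floor_pos.2 hq))
    have hj1 : ((j + 1 : ℕ) : ℝ) ≤ ρ / τ := by
      rw [← Nat.succ_eq_add_one, ← hj]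
      exact Nat.floor_le (by positivity)
    have hj2 : ρ / τ < ((j + 1 : ℕ) : ℝ) + 1 := by
      rw [← Nat.succ_eq_add_one, ← hj]
      exact Nat.lt_floor_add_one _
    rw [le_div_iff₀ hτ] at hj1
    rw [div_lt_iff₀ hτ] at hj2
    have hρr' : ρ ≤ r := div_le_self hr (by linarith)
    refine ⟨j, hle _ (hj1.trans hρr'), hj1.trans hρr', ?_, ?_⟩
    · have h2 : 4 * γ * (((j + 1 : ℕ) : ℝ) * τ) ≤ 4 * γ * ρ := by gcongr
      refine h2.trans ?_
      rw [hρ, ← mul_div_assoc, div_le_one h1]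
      linarith
    · have h2 : ρ ≤ 2 * (((j + 1 : ℕ) : ℝ) * τ) := by
        push_cast at hj2 ⊢
        nlinarith [(Nat.cast_nonneg j : (0 : ℝ) ≤ j)]
      have := mul_le_mul_of_nonneg_right h2 h1.le
      rwa [hρr] at this

/-- Bounding the integrand on `[0, 3 κ]` by its endpoint value leaves `(4 l + 3 η) κ ≤ 3 / 8` and
`exp (-3 / 8) ≥ (7 / 8) ^ 3 ≥ 2 / 3`. The factor `3` in the regularization parameter pays for the
factor `2` and the exponentials. -/
theorem two_mul_mul_exp_le_expPrimitive {l η γ κ r : ℝ} (hl : 0 ≤ l) (hη : 0 ≤ η)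
    (hγ : γ = 2 * η + 3 * l) (hκ : 0 ≤ κ) (hκr : κ ≤ r) (hγκ : 4 * γ * κ ≤ 1) :
    2 * (κ * Real.exp (l * κ)) ≤ expPrimitive (-(l + η)) (3 * r) := by
  have h1 := mul_exp_le_expPrimitive (μ := -(l + η)) (by linarith) (by positivity : 0 ≤ 3 * κ)
  refine le_trans ?_ (h1.trans (expPrimitive_mono_right _ (by linarith)))
  have h2 : (2 : ℝ) / 3 ≤ Real.exp (-(3 / 8)) := by
    have h3 : (7 / 8 : ℝ) ≤ Real.exp (-(1 / 8)) := by
      linarith [Real.add_one_le_exp (-(1 / 8) : ℝ)]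
    have h4 := pow_le_pow_left₀ (by norm_num) h3 3
    rw [← Real.exp_nat_mul] at h4
    norm_num at h4 ⊢
    linarith
  have h5 : Real.exp (-(3 / 8)) * Real.exp (l * κ) ≤ Real.exp (-(l + η) * (3 * κ)) := by
    rw [← Real.exp_add, Real.exp_le_exp]
    rw [hγ] at hγκ
    nlinarith [mul_nonneg hl hκ, mul_nonneg hη hκ]
  have h6 : 2 / 3 * Real.exp (l * κ) ≤ Real.exp (-(l + η) * (3 * κ)) :=
    (mul_le_mul_of_nonneg_right h2 (Real.exp_pos _).le).trans h5
  nlinarith [mul_le_mul_of_nonneg_left h6 hκ]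

/-- The term `γ r` is the geometric mean of `γ τ ≤ 1 / 4` and `γ T`, so it grows at most linearly in
`γ T` and is absorbed by a second `exp (γ T)`. -/
theorem error_constant_le {γ τ T r : ℝ} (hγ : 0 ≤ γ) (hT : 0 ≤ T)
    (hγτ : 4 * γ * τ ≤ 1) (hr : 0 ≤ r) (hr2 : r ^ 2 = τ * T) :
    Real.exp (γ * T) * (2 + √(8 * (1 + 4 * γ * r))) ≤ 10 * Real.exp (2 * γ * T) := by
  have hγr : 0 ≤ γ * r := mul_nonneg hγ hr
  have hγT : 0 ≤ γ * T := mul_nonneg hγ hT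
  have h1 : √(8 * (1 + 4 * γ * r)) ≤ 3 + 6 * (γ * r) := by
    refine Real.sqrt_le_iff.2 ⟨by linarith, ?_⟩
    nlinarith
  have h2 : γ * r ≤ (1 + γ * T) / 4 := by
    refine abs_le_of_sq_le_sq' ?_ (by linarith) |>.2
    have h3 : (γ * r) ^ 2 = (γ * τ) * (γ * T) := by rw [mul_pow, hr2]; ring
    rw [h3]
    nlinarith [sq_nonneg (1 - γ * T)]
  have h4 := Real.add_one_le_exp (γ * T)
  calc Real.exp (γ * T) * (2 + √(8 * (1 + 4 * γ * r)))
      ≤ Real.exp (γ * T) * (10 * Real.exp (γ * T)) := by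
        refine mul_le_mul_of_nonneg_left ?_ (Real.exp_pos _).le
        linarith
    _ = 10 * Real.exp (2 * γ * T) := by
        rw [show 2 * γ * T = γ * T + γ * T by ring, Real.exp_add]; ring

/-! ### Moreau-Yosida regularization and energy drops -/

variable {X : Type*} [MetricSpace X] {φ : X → EReal} {lam τ η : ℝ} {D : Set X} {S : ℝ → X → X}

/-- Finiteness of the Moreau-Yosida regularization below the critical parameter. -/
theorem IsEVIGradientFlow.exists_moreauYosida_eq_coe (hφ : ∀ x, φ x ≠ ⊥)
    (hlsc : LowerSemicontinuous φ) (hS : IsEVIGradientFlow φ lam D S) {x : X}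
    (hx : x ∈ D ∩ dom φ) {s σ : ℝ} (hs : 0 < s) (hσ : 0 < σ) (hσs : σ ≤ expPrimitive lam s) :
    ∃ m : ℝ, moreauYosida φ σ x = m ∧
      ∀ v ∈ dom φ, m ≤ (φ v).toReal + 1 / (2 * σ) * dist v x ^ 2 := by
  -- Nonnegativity of the left side of the integrated EVI shows that the energy of `S s x` bounds
  -- the infimum from below.
  have hlow : ((φ (S s x)).toReal : EReal) ≤ moreauYosida φ σ x := by
    refine le_iInf fun v => ?_
    by_cases hv : v ∈ dom φ
    · rw [← coe_toReal_of_mem_dom hφ hv, ← EReal.coe_add, EReal.coe_le_coe_iff]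
      have h1 := hS.dist_sq_le hφ hlsc hx.1 hs hv
      have h2 := expPrimitive_neg_mul_exp (-lam) s
      rw [neg_neg] at h2
      rw [← h2, dist_comm x v] at h1
      have hexp := Real.exp_pos (-lam * s)
      have h3 : 0 ≤ Real.exp (-lam * s) * (dist v x ^ 2
          + 2 * expPrimitive lam s * ((φ v).toReal - (φ (S s x)).toReal)) := by
        have := sq_nonneg (dist (S s x) v)
        linarith
      have h4 := nonneg_of_mul_nonneg_right h3 hexp
      have h5 : 0 < expPrimitive lam s := hσ.trans_le hσs
      have h6 : (φ (S s x)).toReal - (φ v).toReal ≤ dist v x ^ 2 / (2 * expPrimitive lam s) := by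
        rw [le_div_iff₀ (by positivity)]
        linarith
      have h7 : dist v x ^ 2 / (2 * expPrimitive lam s) ≤ dist v x ^ 2 / (2 * σ) := by gcongr
      rw [one_div_mul_eq_div]
      linarith
    · have : φ v = ⊤ := not_lt_top_iff.1 hv
      rw [this, EReal.top_add_coe]
      exact le_top
  have hup : ∀ v ∈ dom φ, moreauYosida φ σ x ≤
      (((φ v).toReal + 1 / (2 * σ) * dist v x ^ 2 : ℝ) : EReal) := fun v hv => by
    rw [EReal.coe_add, coe_toReal_of_mem_dom hφ hv]
    exact iInf_le _ v
  have heq : ((moreauYosida φ σ x).toReal : EReal) = moreauYosida φ σ x :=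
    EReal.coe_toReal (ne_of_lt ((hup x hx.2).trans_lt (EReal.coe_lt_top _)))
      (ne_of_gt ((EReal.bot_lt_coe _).trans_le hlow))
  refine ⟨_, heq.symm, fun v hv => ?_⟩
  have := hup v hv
  rwa [← heq, EReal.coe_le_coe_iff] at this

/-- Energy drops over distances that are small with respect to the regularization parameter. -/
theorem sub_le_two_mul_of_sq_le {a b m d σ κ : ℝ} (hσ : 0 < σ) (hκ : 0 < κ) (hκσ : 2 * κ ≤ σ)
    (hm : m ≤ b + 1 / (2 * σ) * d ^ 2) (hd : d ^ 2 ≤ 2 * κ * (a - b)) : a - b ≤ 2 * (a - m) := by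
  have h1 : 0 ≤ a - b := nonneg_of_mul_nonneg_right ((sq_nonneg d).trans hd) (by positivity)
  have h2 : d ^ 2 / (2 * σ) ≤ (a - b) / 2 := by
    rw [div_le_iff₀ (by positivity)]
    nlinarith
  rw [one_div_mul_eq_div] at hm
  linarith

theorem IsDiscreteMinimizingMovement.sum_dist_sq_le (hφ : ∀ x, φ x ≠ ⊥) (hτ : 0 < τ)
    {U : ℕ → X} (hU : IsDiscreteMinimizingMovement φ τ η U) (n : ℕ) :
    ∑ i ∈ Finset.range n, dist (U i) (U (i + 1)) ^ 2 ≤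
      2 * τ * ((φ (U 0)).toReal - (φ (U n)).toReal) := by
  induction n with
  | zero => simp
  | succ n ih =>
    rw [Finset.sum_range_succ]
    have := dist_sq_le_of_mem_resolvent hφ hτ (hU.1 n) (hU.2 n)
    linarith

/-- Cauchy-Schwarz over the steps. The form matches the integrated EVI tested at the initial point,
so `sub_le_two_mul_of_sq_le` serves scheme and flow alike. -/
theorem IsDiscreteMinimizingMovement.dist_zero_sq_le (hφ : ∀ x, φ x ≠ ⊥) (hτ : 0 < τ)
    {U : ℕ → X} (hU : IsDiscreteMinimizingMovement φ τ η U) (n : ℕ) :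
    dist (U 0) (U n) ^ 2 ≤ 2 * (n * τ) * ((φ (U 0)).toReal - (φ (U n)).toReal) := by
  have h1 := pow_le_pow_left₀ dist_nonneg (dist_le_range_sum_dist U n) 2
  have h2 := sq_sum_le_card_mul_sum_sq (s := Finset.range n)
    (f := fun i => dist (U i) (U (i + 1)))
  rw [Finset.card_range] at h2
  have h3 := mul_le_mul_of_nonneg_left (hU.sum_dist_sq_le hφ hτ n) (Nat.cast_nonneg n)
  linarith

end EVIFlow

/-! ### Global error estimate -/

namespace EVIFlow

open Filter Topology Set

variable {X : Type*} [MetricSpace X] {φ : X → EReal} {lam τ η γ : ℝ} {D : Set X} {S : ℝ → X → X}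

/-- Propagation of the error between the flow and a Minimizing Movement. -/
theorem IsEVIGradientFlow.dist_interp_le (hφ : ∀ x, φ x ≠ ⊥) (hlsc : LowerSemicontinuous φ)
    (hlam : lam ≤ 0) (hS : IsEVIGradientFlow φ lam D S) (hconv : ApproxConvexIn φ lam D)
    (hτ : 0 < τ) (hη : 0 ≤ η) (hγ : γ = 2 * η - 3 * lam) (hγτ : 4 * γ * τ ≤ 1) {U : ℕ → X}
    (hUD : ∀ n, U n ∈ D) (hU : IsDiscreteMinimizingMovement φ τ η U) {x : X} (hx : x ∈ D)
    {s : ℝ} (hs : 0 ≤ s) (j n : ℕ) :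
    dist (S (s + n * τ) x) (U (j + n + 1)) ≤
      Real.exp (-lam * τ) ^ n * dist (S s x) (U (j + 1))
        + (Real.exp (-lam * τ) * Real.exp (3 / 5 * γ * τ)) ^ n
          * √(n * dist (U j) (U (j + 1)) ^ 2) := by
  have hγ0 : 0 ≤ γ := by rw [hγ]; linarith
  -- The error of a step is controlled by the displacement of the preceding one, so the recursion
  -- starts at `U (j + 1)` with `c 0` the displacement from `U j`.
  have h := le_of_telescoping_recursion
    (e := fun i => dist (S (s + i * τ) x) (U (j + i + 1)))
    (w := fun i => dist (S τ (U (j + i + 1))) (U (j + i + 2)))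
    (c := fun i => dist (U (j + i)) (U (j + i + 1)) ^ 2)
    (A := Real.exp (-lam * τ)) (R := Real.exp (3 / 5 * γ * τ))
    (Real.one_le_exp (mul_nonneg (by linarith) hτ.le))
    (Real.one_le_exp (by positivity)) ?_ (fun i => sq_nonneg _) ?_ n
  · simpa using h
  · intro i
    have hsi : 0 ≤ s + i * τ := by positivity
    have h1 : S (s + ((i + 1 : ℕ) : ℝ) * τ) x = S τ (S (s + i * τ) x) := by
      rw [← hS.semigroup x hx _ _ hsi hτ.le]
      congr 1
      push_cast
      ring
    simp only [h1]
    refine (dist_triangle _ (S τ (U (j + i + 1))) _).trans (add_le_add ?_ le_rfl)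
    exact hS.dist_le hφ hlsc (hS.mapsTo _ hsi hx) (hUD _) hτ.le
  · intro i
    have h1 := hS.dist_sq_step_le hφ hlam hconv hτ hη hγ hγτ (hU.2 (j + i)) (hUD _)
      (hU.2 (j + i + 1)) (hUD _)
    have h2 : Real.exp (3 / 5 * γ * τ) ^ 2 = Real.exp (6 / 5 * γ * τ) := by
      rw [← Real.exp_nat_mul]
      congr 1
      push_cast
      ring
    rw [h2]
    exact h1

/-- Regularization of the displacement along a Minimizing Movement. -/
theorem IsEVIGradientFlow.succ_mul_dist_sq_le (hφ : ∀ x, φ x ≠ ⊥)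
    (hlam : lam ≤ 0) (hS : IsEVIGradientFlow φ lam D S) (hconv : ApproxConvexIn φ lam D)
    (hτ : 0 < τ) (hη : 0 ≤ η) (hγ : γ = 2 * η - 3 * lam) (hγτ : 4 * γ * τ ≤ 1) {U : ℕ → X}
    (hUD : ∀ n, U n ∈ D) (hU : IsDiscreteMinimizingMovement φ τ η U) (j : ℕ) :
    (j + 1) * dist (U j) (U (j + 1)) ^ 2 ≤ (Real.exp (3 / 5 * γ * τ) ^ j) ^ 2
      * (2 * τ * ((φ (U 0)).toReal - (φ (U (j + 1))).toReal)) := by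
  have hγ0 : 0 ≤ γ := by rw [hγ]; linarith
  have h1 := mul_le_pow_mul_sum (c := fun i => dist (U i) (U (i + 1)) ^ 2)
    (Q := Real.exp (6 / 5 * γ * τ)) (Real.one_le_exp (by positivity)) (fun i => sq_nonneg _)
    (fun i => by
      have := hS.dist_sq_step_le hφ hlam hconv hτ hη hγ hγτ (hU.2 i) (hUD _) (hU.2 (i + 1))
        (hUD _)
      have := sq_nonneg (dist (S τ (U (i + 1))) (U (i + 2)))
      simp only [add_assoc, Nat.reduceAdd] at *
      linarith) j
  have h2 : (Real.exp (3 / 5 * γ * τ) ^ j) ^ 2 = Real.exp (6 / 5 * γ * τ) ^ j := by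
    rw [← pow_mul, mul_comm j 2, pow_mul, ← Real.exp_nat_mul]
    congr 2
    push_cast
    ring
  rw [h2]
  exact h1.trans (mul_le_mul_of_nonneg_left (hU.sum_dist_sq_le hφ hτ (j + 1)) (by positivity))

/-- Distance between the flow and the Minimizing Movement after a short initial time. -/
theorem IsEVIGradientFlow.dist_sq_initial_le (hφ : ∀ x, φ x ≠ ⊥) (hlsc : LowerSemicontinuous φ)
    (hlam : lam ≤ 0) (hS : IsEVIGradientFlow φ lam D S) {x v : X} (hx : x ∈ D ∩ dom φ)
    (hv : v ∈ dom φ) {s κ M : ℝ} (hs : 0 < s) (hsκ : s ≤ κ)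
    (hxv : dist x v ^ 2 ≤ 2 * κ * ((φ x).toReal - (φ v).toReal))
    (hvM : (φ x).toReal - (φ v).toReal ≤ 2 * M)
    (hsM : (φ x).toReal - (φ (S s x)).toReal ≤ 2 * M) :
    dist (S s x) v ^ 2 ≤ Real.exp (-lam * s) * (4 * κ * M) := by
  have h1 := hS.dist_sq_le hφ hlsc hx.1 hs hv
  have hl : 0 ≤ -lam := by linarith
  have hE : expPrimitive (-lam) s ≤ κ * Real.exp (-lam * s) :=
    (expPrimitive_le_mul_exp hl hs.le).trans
      (mul_le_mul_of_nonneg_right hsκ (Real.exp_pos _).le)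
  have hE0 := expPrimitive_nonneg (-lam) hs.le
  have hexp := Real.exp_pos (-lam * s)
  have h2 := mul_le_mul_of_nonneg_left hxv hexp.le
  have hκe : 0 ≤ κ * Real.exp (-lam * s) := hE0.trans hE
  -- Either the energy term is nonpositive, or it adds to the bound on `dist x v ^ 2` so that `φ v`
  -- cancels and only the drop along the flow remains.
  rcases le_total ((φ v).toReal) ((φ (S s x)).toReal) with h | h
  · have h3 : 2 * expPrimitive (-lam) s * ((φ v).toReal - (φ (S s x)).toReal) ≤ 0 :=
      mul_nonpos_of_nonneg_of_nonpos (by linarith) (by linarith)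
    have h4 := mul_le_mul_of_nonneg_left hvM hκe
    linarith
  · have h3 := mul_le_mul_of_nonneg_right hE (sub_nonneg.2 h)
    have h4 := mul_le_mul_of_nonneg_left hsM hκe
    linarith

/-- The error estimate for the flow and the Minimizing Movement starting from the same point. -/
theorem IsEVIGradientFlow.dist_le_same_initial (hφ : ∀ x, φ x ≠ ⊥)
    (hlsc : LowerSemicontinuous φ) (hlam : lam ≤ 0) (hS : IsEVIGradientFlow φ lam D S)
    (hconv : ApproxConvexIn φ lam D) (hτ : 0 < τ) (hη : 0 ≤ η) (hγ : γ = 2 * η - 3 * lam)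
    (hγτ : 4 * γ * τ ≤ 1) {U : ℕ → X} (hUD : ∀ n, U n ∈ D)
    (hU : IsDiscreteMinimizingMovement φ τ η U) {N : ℕ} (hN : 1 ≤ N) {t r m : ℝ}
    (ht1 : (N - 1) * τ < t) (ht2 : t ≤ N * τ) (hr : 0 ≤ r) (hr2 : r ^ 2 = τ * (N * τ))
    (hm : ∀ v ∈ dom φ, m ≤ (φ v).toReal
      + 1 / (2 * expPrimitive (lam - η) (3 * r)) * dist v (U 0) ^ 2) :
    dist (S t (U 0)) (U N) ≤
      10 * √r * Real.exp (2 * γ * (N * τ)) * √((φ (U 0)).toReal - m) := by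
  have hγ0 : 0 ≤ γ := by rw [hγ]; linarith
  obtain ⟨j, hjN, hκr, hγκ, hrκ⟩ := exists_initial_steps hτ hγ0 hγτ hN hr hr2
  obtain ⟨n, rfl⟩ := Nat.exists_eq_add_of_le hjN
  set κ := ((j + 1 : ℕ) : ℝ) * τ with hκ
  have hκ0 : 0 < κ := by positivity
  set l := -lam with hl
  have hl0 : 0 ≤ l := by linarith
  set T := ((j + 1 + n : ℕ) : ℝ) * τ with hT
  set M := (φ (U 0)).toReal - m with hM
  set σ := expPrimitive (lam - η) (3 * r) with hσ
  have hTκ : T = κ + n * τ := by rw [hT, hκ]; push_cast; ring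
  have hσκ : 2 * (κ * Real.exp (l * κ)) ≤ σ := by
    have := two_mul_mul_exp_le_expPrimitive hl0 hη (γ := γ) (by rw [hγ, hl]; ring) hκ0.le hκr hγκ
    rwa [show -(l + η) = lam - η by rw [hl]; ring] at this
  have hκσ : 2 * κ ≤ σ := by
    have : 1 ≤ Real.exp (l * κ) := Real.one_le_exp (by positivity)
    linarith [mul_le_mul_of_nonneg_left this hκ0.le]
  have hσ0 : 0 < σ := by linarith
  -- The off-grid part of `t` is moved into the initial layer: `s` lies in `(0, κ]`, and afterwards
  -- both evolutions advance by whole steps.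
  set s := t - n * τ with hs
  have hs0 : 0 < s := by
    rw [hs]
    have : ((j + 1 + n : ℕ) : ℝ) - 1 = j + n := by push_cast; ring
    rw [this] at ht1
    have : 0 ≤ (j : ℝ) * τ := by positivity
    linarith
  have hsκ : s ≤ κ := by rw [hs]; linarith
  have h0 : U 0 ∈ D ∩ dom φ := ⟨hUD 0, hU.1 0⟩
  have hdj := hU.dist_zero_sq_le hφ hτ (j + 1)
  rw [← hκ] at hdj
  have hΔj : (φ (U 0)).toReal - (φ (U (j + 1))).toReal ≤ 2 * M :=
    sub_le_two_mul_of_sq_le hσ0 hκ0 hκσ (hm _ (hU.1 (j + 1)))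
      (by rw [dist_comm]; exact hdj)
  have hsol := hS.isEVISolution _ h0.1
  have hΔs : (φ (U 0)).toReal - (φ (S s (U 0))).toReal ≤ 2 * M := by
    have hE0 : 0 < expPrimitive l s := hs0.trans_le (le_expPrimitive hl0 hs0.le)
    refine sub_le_two_mul_of_sq_le hσ0 hE0 ?_ (hm _ (hsol.mem_dom s hs0)) ?_
    · have h1 : expPrimitive l s ≤ κ * Real.exp (l * κ) :=
        (expPrimitive_mono_right l hsκ).trans (expPrimitive_le_mul_exp hl0 hκ0.le)
      linarith
    · simpa using hS.dist_sq_le hφ hlsc h0.1 hs0 h0.2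
  have hM0 : 0 ≤ M := by
    have := nonneg_of_mul_nonneg_right ((sq_nonneg _).trans hdj) (by positivity)
    linarith
  have hinit := hS.dist_sq_initial_le hφ hlsc hlam h0 (hU.1 (j + 1)) hs0 hsκ hdj hΔj hΔs
  have hprop := hS.dist_interp_le hφ hlsc hlam hconv hτ hη hγ hγτ hUD hU h0.1 hs0.le j n
  have hreg := hS.succ_mul_dist_sq_le hφ hlam hconv hτ hη hγ hγτ hUD hU j
  rw [← hl] at hinit hprop
  have hst : s + n * τ = t := by rw [hs]; ring
  rw [hst, show j + n + 1 = j + 1 + n by ring] at hprop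
  have hrM : 0 ≤ √(r * M) := Real.sqrt_nonneg _
  have hT0 : 0 ≤ T := by positivity
  have hlγ : l ≤ γ / 3 := by rw [hγ, hl]; linarith
  -- contribution of the initial layer
  have hA : Real.exp (l * τ) ^ n * dist (S s (U 0)) (U (j + 1)) ≤
      Real.exp (γ * T) * (2 * √(r * M)) := by
    have h1 : dist (S s (U 0)) (U (j + 1)) ≤ Real.exp (l * κ) * (2 * √(r * M)) := by
      refine abs_le_of_sq_le_sq' (hinit.trans ?_) (by positivity) |>.2
      rw [mul_pow, mul_pow, Real.sq_sqrt (by positivity)]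
      have h2 : Real.exp (l * s) ≤ Real.exp (l * κ) ^ 2 := by
        rw [← Real.exp_nat_mul, Real.exp_le_exp]
        push_cast
        linarith [mul_le_mul_of_nonneg_left hsκ hl0, mul_nonneg hl0 hκ0.le]
      have h3 : 4 * κ * M ≤ 2 ^ 2 * (r * M) := by
        linarith [mul_le_mul_of_nonneg_right hκr hM0]
      exact mul_le_mul h2 h3 (by positivity) (by positivity)
    calc Real.exp (l * τ) ^ n * dist (S s (U 0)) (U (j + 1))
        ≤ Real.exp (l * τ) ^ n * (Real.exp (l * κ) * (2 * √(r * M))) := by gcongr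
      _ = Real.exp (l * T) * (2 * √(r * M)) := by
        rw [← mul_assoc, ← Real.exp_nat_mul, ← Real.exp_add, hTκ]
        congr 2
        ring
      _ ≤ Real.exp (γ * T) * (2 * √(r * M)) := by
        gcongr
        linarith
  -- contribution of the local errors
  have hB : (Real.exp (l * τ) * Real.exp (3 / 5 * γ * τ)) ^ n
      * √(n * dist (U j) (U (j + 1)) ^ 2) ≤
      Real.exp (γ * T) * (√(8 * (1 + 4 * γ * r)) * √(r * M)) := by
    set R := Real.exp (3 / 5 * γ * τ) with hR
    have hd : κ * dist (U j) (U (j + 1)) ^ 2 ≤ (R ^ j) ^ 2 * (4 * τ ^ 2 * M) := by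
      have h1 := mul_le_mul_of_nonneg_left hΔj (by positivity : 0 ≤ (R ^ j) ^ 2 * (2 * τ ^ 2))
      have h2 := mul_le_mul_of_nonneg_left hreg hτ.le
      have h3 : κ = τ * (j + 1) := by rw [hκ]; push_cast; ring
      rw [h3]
      linarith
    have hnT : (n : ℝ) * τ ^ 2 ≤ r ^ 2 := by
      have h1 : n * τ ≤ T := by linarith
      rw [hr2]
      linarith [mul_le_mul_of_nonneg_left h1 hτ.le]
    have h1 : √(n * dist (U j) (U (j + 1)) ^ 2) ≤
        R ^ j * (√(8 * (1 + 4 * γ * r)) * √(r * M)) := by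
      have h8 : 0 ≤ 8 * (1 + 4 * γ * r) := by positivity
      refine Real.sqrt_le_iff.2 ⟨by positivity, ?_⟩
      rw [mul_pow, mul_pow, Real.sq_sqrt h8, Real.sq_sqrt (by positivity)]
      refine le_of_mul_le_mul_left ?_ hκ0
      calc κ * (n * dist (U j) (U (j + 1)) ^ 2)
          = n * (κ * dist (U j) (U (j + 1)) ^ 2) := by ring
        _ ≤ n * ((R ^ j) ^ 2 * (4 * τ ^ 2 * M)) := by gcongr
        _ = (R ^ j) ^ 2 * (4 * M) * (n * τ ^ 2) := by ring
        _ ≤ (R ^ j) ^ 2 * (4 * M) * (r * r) := by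
          rw [← pow_two]
          gcongr
        -- One factor `r` is traded for `κ`, which cancels the weight gained from regularization.
        _ ≤ (R ^ j) ^ 2 * (4 * M) * (r * (2 * κ * (1 + 4 * γ * r))) := by gcongr
        _ = κ * ((R ^ j) ^ 2 * (8 * (1 + 4 * γ * r) * (r * M))) := by ring
    refine (mul_le_mul_of_nonneg_left h1 (by positivity)).trans ?_
    rw [← mul_assoc]
    refine mul_le_mul_of_nonneg_right ?_ (by positivity)
    -- The rates fit because `l ≤ γ / 3` and `1 / 3 + 3 / 5 < 1`.
    rw [hR, ← Real.exp_add, ← Real.exp_nat_mul, ← Real.exp_nat_mul, ← Real.exp_add,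
      Real.exp_le_exp]
    have h2 : T = (j + 1 + n) * τ := by rw [hT]; push_cast; ring
    have h3 : (n : ℝ) * (l * τ) ≤ n * (γ / 3 * τ) := by gcongr
    have h4 : 0 ≤ (n : ℝ) * (γ * τ) := by positivity
    have h5 : 0 ≤ (j : ℝ) * (γ * τ) := by positivity
    have h6 : 0 ≤ γ * τ := by positivity
    rw [h2]
    linarith
  have hconst := error_constant_le hγ0 hT0 hγτ hr hr2
  have hsq : √(r * M) = √r * √M := Real.sqrt_mul hr M
  calc dist (S t (U 0)) (U (j + 1 + n))
      ≤ Real.exp (γ * T) * (2 * √(r * M))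
        + Real.exp (γ * T) * (√(8 * (1 + 4 * γ * r)) * √(r * M)) := hprop.trans (add_le_add hA hB)
    _ = Real.exp (γ * T) * (2 + √(8 * (1 + 4 * γ * r))) * √(r * M) := by ring
    _ ≤ 10 * Real.exp (2 * γ * T) * √(r * M) := mul_le_mul_of_nonneg_right hconst hrM
    _ = 10 * √r * Real.exp (2 * γ * T) * √M := by rw [hsq]; ring

end EVIFlow

theorem theorem5p9 {X : Type*} [MetricSpace X] (φ : X → EReal)
    (hφ_bot : ∀ x, φ x ≠ ⊥) (hφ_proper : (EVIFlow.dom φ).Nonempty)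
    (hφ_lsc : LowerSemicontinuous φ)
    (lam : ℝ) (hlam : lam ≤ 0) (D : Set X) (S : ℝ → X → X)
    (hS : EVIFlow.IsEVIGradientFlow φ lam D S)
    (τ η γ : ℝ) (hτ : τ ∈ Set.Ioo (0 : ℝ) 1) (hη : 0 ≤ η)
    (hγ : γ = 2 * η - 3 * lam) (hγτ : 4 * γ * τ ≤ 1)
    (U : ℕ → X) (hUD : ∀ n, U n ∈ D ∩ EVIFlow.dom φ)
    (hU : EVIFlow.IsDiscreteMinimizingMovement φ τ η U)
    (hconv : EVIFlow.ApproxConvexIn φ lam D) :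
    ∀ u₀ ∈ D, ∀ t : ℝ, 0 < t →
      -- the regularization in the error bound is finite, so that `toReal` loses nothing
      EVIFlow.moreauYosida φ
          (EVIFlow.expPrimitive (lam - η) (3 * √(τ * EVIFlow.gridTime τ t))) (U 0) ≠ ⊥ ∧
      EVIFlow.moreauYosida φ
          (EVIFlow.expPrimitive (lam - η) (3 * √(τ * EVIFlow.gridTime τ t))) (U 0) ≠ ⊤ ∧
      dist (S t u₀) (EVIFlow.interpolant τ U t) ≤
        Real.exp (-lam * t) * dist u₀ (U 0)
          + 10 * (τ * EVIFlow.gridTime τ t) ^ ((1 : ℝ) / 4)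
            * Real.exp (2 * γ * EVIFlow.gridTime τ t)
            * √((φ (U 0) - EVIFlow.moreauYosida φ
                (EVIFlow.expPrimitive (lam - η) (3 * √(τ * EVIFlow.gridTime τ t))) (U 0)).toReal) := by
  intro u₀ hu₀ t ht
  obtain ⟨hτ0, -⟩ := hτ
  have hN : 1 ≤ ⌈t / τ⌉₊ := Nat.one_le_ceil_iff.2 (div_pos ht hτ0)
  set N := ⌈t / τ⌉₊ with hNdef
  have ht2 : t ≤ N * τ := (div_le_iff₀ hτ0).1 (Nat.le_ceil _)
  have ht1 : (N - 1) * τ < t := by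
    rw [← lt_div_iff₀ hτ0]
    linarith [Nat.ceil_lt_add_one (div_pos ht hτ0).le]
  have hgrid : EVIFlow.gridTime τ t = N * τ := rfl
  have hinterp : EVIFlow.interpolant τ U t = U N := rfl
  rw [hgrid, hinterp]
  set r := √(τ * (N * τ)) with hr
  have hr0 : 0 < r := Real.sqrt_pos.2 (by positivity)
  have hr2 : r ^ 2 = τ * (N * τ) := Real.sq_sqrt (by positivity)
  have hσ0 : 0 < EVIFlow.expPrimitive (lam - η) (3 * r) :=
    lt_of_lt_of_le (by positivity)
      (EVIFlow.mul_exp_le_expPrimitive (μ := lam - η) (by linarith)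
        (by positivity : 0 ≤ 3 * r))
  -- The flow is run for time `3 * r`; lowering the rate from `lam` to `lam - η` only decreases the
  -- primitive.
  obtain ⟨m, hmeq, hm⟩ := hS.exists_moreauYosida_eq_coe hφ_bot hφ_lsc (hUD 0)
    (by positivity : 0 < 3 * r) hσ0
    (EVIFlow.expPrimitive_mono_left (by linarith) (by positivity))
  rw [hmeq, ← EVIFlow.coe_toReal_of_mem_dom hφ_bot (hUD 0).2, ← EReal.coe_sub, EReal.toReal_coe]
  refine ⟨EReal.coe_ne_bot m, EReal.coe_ne_top m, ?_⟩
  have h4 : (τ * (N * τ)) ^ ((1 : ℝ) / 4) = √r := by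
    rw [hr, Real.sqrt_eq_rpow, Real.sqrt_eq_rpow, ← Real.rpow_mul (by positivity)]
    norm_num
  rw [h4]
  exact (dist_triangle _ (S t (U 0)) _).trans (add_le_add
    (hS.dist_le hφ_bot hφ_lsc hu₀ (hUD 0).1 ht.le)
    (hS.dist_le_same_initial hφ_bot hφ_lsc hlam hconv hτ0 hη hγ hγτ (fun n => (hUD n).1) hU hN
      ht1 ht2 hr0.le hr2 hm))
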